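/- **Setting (the 7-point problem).** Let $\mathcal{X}=(\mathbb{R}^2\times\mathbb{R}^2)^{7}$ be the space of image data $x=((\gamma_1,\bar\gamma_1),\dots,(\gamma_7,\bar\gamma_7))$. Let $\mathcal{W}$ be the 28-dimensional manifold of world scenes: tuples $(P,\bar P,\tilde\Gamma_1,\dots,\tilde\Gamma_7)$ of two projective cameras $P,\bar P\in\mathbb{P}(\mathbb{R}^{3\times4})$ of rank $3$ with $\ker P\neq\ker\bar P$ and seven world points $\tilde\Gamma_i\in\mathbb{P}^3_{\mathbb{R}}$ with $(P\tilde\Gamma_i)_3\neq0$ and $(\bar P\tilde\Gamma_i)_3\neq 0$, modulo the action $g\cdot(P,\bar P,\tilde\Gamma_i)=(Pg^{-1},\bar Pg^{-1},g\tilde\Gamma_i)$ of $\mathrm{PGL}(4)$. The forward map $\Phi:\mathcal{W}\to\mathcal{X}$ is $\gamma_i=\pi(P\tilde\Gamma_i)$, $\bar\gamma_i=\pi(\bar P\tilde\Gamma_i)$, where $\pi(x,y,z)=(x/z,y/z)$. The ill-posed locus in $\mathcal{W}$ is the set of $w\in\mathcal{W}$ at which the differential $D\Phi(w)$ is rank-deficient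 (rank less than $28$), and the ill-posed locus $\mathrm{ill}(\mathcal{X})\subseteq\mathcal{X}$ is its image under $\Phi$. For $x\in\mathcal{X}$ let $\mathbf{L}(x)$ be the $7\times9$ matrix whose $i$-th row is the linear form $F\mapsto(\bar\gamma_i;1)^{\top}F(\gamma_i;1)$ on $\mathbb{R}^{3\times3}=\mathbb{R}^9$ (entries of $F$ listed row by row), and for $1\le i<j\le 9$ let $p_{ij}(x)$ be $(-1)^{i+j}$ times the maximal minor of $\mathbf{L}(x)$ obtained by dropping the columns $i$ and $j$. If $\mathbf{L}(x)$ has rank $7$, these are the Plücker coordinates of the 2-dimensional space $\ker\mathbf{L}(x)\subseteq\mathbb{R}^9$. **Theorem.** There is a polynomial $\mathbf{P}$ with integer coefficients in $36$ variables $p_{ij}$, $1\le i<j\le9$ (Plücker coordinates of 2-dimensional subspaces of $\mathbb{R}^9$), such that: 1. $\mathbf{P}$ is homogeneous of degree $6$, has exactly $1668$ monomial terms, and all its coefficients have absolute value at most $72$; 2. for all $F_1,F_2\in\mathbb{R}^{3\times3}$, the value of $\mathbf{P}$ at the $2\times2$ minors $p_{ij}=(F_1)_i(F_2)_j-(F_1)_j(F_2)_i$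 is the discriminant $b^2c^2-4ac^3-4b^3d-27a^2d^2+18abcd$ of the cubic $\det(tF_1+F_2)=at^3+bt^2+ct+d$; 3. the polynomial $x\mapsto\mathbf{P}(p_{ij}(x))$ in the $28$ entries of $\gamma_1,\dots,\bar\gamma_7$ has degree $6$ separately in each of the $14$ image points $\gamma_1,\bar\gamma_1,\dots,\gamma_7,\bar\gamma_7$; 4. if $x\in\mathrm{ill}(\mathcal{X})$, then $\mathbf{P}(p_{ij}(x))=0$. -/

import Mathlib

namespace SevenPoint

noncomputable section

/-! ### Image data -/

/-- Seven point pairs `((γ₁, γ̄₁), …, (γ₇, γ̄₇))`, with entries in `R`.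
For `R = ℝ` this is the image data space `𝒳 = (ℝ² × ℝ²)⁷`, of dimension 28. -/
abbrev ImageData (R : Type) : Type := Fin 7 → (Fin 2 → R) × (Fin 2 → R)

open MvPolynomial in
/-- The point of the image-data space whose entries are the variables: the variable `(i, s, c)` is
coordinate `c` of the `i`-th point in the first (`s = 0`) or second (`s = 1`) image. -/
def genericImageData : ImageData (MvPolynomial (Fin 7 × Fin 2 × Fin 2) ℤ) :=
  fun i => (fun c => X (i, 0, c), fun c => X (i, 1, c))

/-- The 28 entries of image data, listed as in `genericImageData`. -/
def entries {R : Type} (x : ImageData R) : Fin 7 × Fin 2 × Fin 2 → R :=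
  fun k => if k.2.1 = 0 then (x k.1).1 k.2.2 else (x k.1).2 k.2.2

/-! ### World scenes -/

/-- The space of tuples `(P, P̄, Γ₁, …, Γ₇)` of homogeneous coordinates of two cameras
(`3 × 4` matrices) and seven world points (vectors in `ℝ⁴`). -/
abbrev Ambient : Type :=
  (Fin 3 → Fin 4 → ℝ) × (Fin 3 → Fin 4 → ℝ) × (Fin 7 → Fin 4 → ℝ)

/-- The conditions on a world scene: both cameras have rank 3, their centers (kernels) are
distinct, and all images of the world points are finite. Since `(P Γᵢ)₃ ≠ 0`, the vectors
`Γᵢ` are nonzero, and hence represent points of the projective space. -/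
structure IsScene (v : Ambient) : Prop where
  rank_fst : (Matrix.of v.1).rank = 3
  rank_snd : (Matrix.of v.2.1).rank = 3
  centers : LinearMap.ker (Matrix.of v.1).mulVecLin ≠ LinearMap.ker (Matrix.of v.2.1).mulVecLin
  finite_fst : ∀ i, (Matrix.of v.1).mulVec (v.2.2 i) 2 ≠ 0
  finite_snd : ∀ i, (Matrix.of v.2.1).mulVec (v.2.2 i) 2 ≠ 0

/-- `(P, P̄, Γ) ↦ (a P h, b P̄ h, c₁ g Γ₁, …, c₇ g Γ₇)`, linear in `(P, P̄, Γ)`. With `h = g⁻¹` this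
is the action of `g` on cameras and points, followed by a rescaling of all homogeneous
coordinates. -/
def transform (g h : Matrix (Fin 4) (Fin 4) ℝ) (a b : ℝ) (c : Fin 7 → ℝ) :
    Ambient →ₗ[ℝ] Ambient where
  toFun v := (fun i j => a * (Matrix.of v.1 * h) i j, fun i j => b * (Matrix.of v.2.1 * h) i j,
    fun k i => c k * (g.mulVec (v.2.2 k)) i)
  map_add' u v := by
    ext <;> simp [← Matrix.of_add_of, Matrix.add_mul, Matrix.mulVec_add, mul_add]
  map_smul' r v := by
    ext <;> simp [← Matrix.smul_of, Matrix.smul_mul, Matrix.mulVec_smul, mul_left_comm]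

/-- Two tuples of homogeneous coordinates give the same world scene: up to rescaling each camera
and each point, they differ by a projective transformation `g ∈ PGL(4)` of the world. -/
def SameScene (u v : Ambient) : Prop :=
  ∃ (g : GL (Fin 4) ℝ) (a b : ℝˣ) (c : Fin 7 → ℝˣ),
    v = transform g (g⁻¹ : GL (Fin 4) ℝ) a b (fun i => c i) u

lemma transform_transform (g h g' h' : Matrix (Fin 4) (Fin 4) ℝ) (a b a' b' : ℝ)
    (c c' : Fin 7 → ℝ) (v : Ambient) :
    transform g' h' a' b' c' (transform g h a b c v) =
      transform (g' * g) (h * h') (a' * a) (b' * b) (fun i => c' i * c i) v := by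
  have e : ∀ (a : ℝ) (M : Matrix (Fin 3) (Fin 4) ℝ),
      Matrix.of (fun i j => a * M i j) = a • M := fun a M => by ext; simp
  have e' : ∀ (a : ℝ) (w : Fin 4 → ℝ), (fun i => a * w i) = a • w := fun a w => by ext; simp
  ext <;> simp [transform, e, e', Matrix.smul_mul, Matrix.mul_assoc, Matrix.mulVec_smul,
    mul_assoc]

lemma SameScene.refl (v : Ambient) : SameScene v v := by
  refine ⟨1, 1, 1, fun _ => 1, ?_⟩
  ext <;> simp [transform]

lemma SameScene.symm {u v : Ambient} (h : SameScene u v) : SameScene v u := by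
  obtain ⟨g, a, b, c, rfl⟩ := h
  refine ⟨g⁻¹, a⁻¹, b⁻¹, fun i => (c i)⁻¹, ?_⟩
  rw [transform_transform]
  ext <;> simp [transform]

lemma SameScene.trans {u v w : Ambient} (h : SameScene u v) (h' : SameScene v w) :
    SameScene u w := by
  obtain ⟨g, a, b, c, rfl⟩ := h
  obtain ⟨g', a', b', c', rfl⟩ := h'
  refine ⟨g' * g, a' * a, b' * b, fun i => c' i * c i, ?_⟩
  rw [transform_transform]
  simp

instance sceneSetoid : Setoid {v : Ambient // IsScene v} where
  r u v := SameScene u.1 v.1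
  iseqv := ⟨fun u => .refl u.1, .symm, .trans⟩

/-- The world scene space `𝒲`: pairs of projective cameras with distinct centers and seven
projective world points with finite images, modulo `PGL(4)`. -/
abbrev WorldScene : Type := Quotient sceneSetoid

/-! ### The forward map -/

/-- `π(x, y, z) = (x / z, y / z)`. -/
def proj (u : Fin 3 → ℝ) : Fin 2 → ℝ := fun c => u c.castSucc / u 2

/-- The forward map in homogeneous coordinates. -/
def forwardRep (v : Ambient) : ImageData ℝ := fun i =>
  (proj ((Matrix.of v.1).mulVec (v.2.2 i)), proj ((Matrix.of v.2.1).mulVec (v.2.2 i)))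

lemma forwardRep_transform (g : GL (Fin 4) ℝ) (a b : ℝˣ) (c : Fin 7 → ℝˣ) (v : Ambient) :
    forwardRep (transform g (g⁻¹ : GL (Fin 4) ℝ) a b (fun i => c i) v) = forwardRep v := by
  have key : ∀ (M : Fin 3 → Fin 4 → ℝ) (w : Fin 4 → ℝ) (a d : ℝˣ),
      proj ((Matrix.of fun i j => (a : ℝ) * (Matrix.of M * ((g⁻¹ : GL (Fin 4) ℝ) :
        Matrix (Fin 4) (Fin 4) ℝ)) i j).mulVec fun i => (d : ℝ) * (g.1.mulVec w) i) =
      proj ((Matrix.of M).mulVec w) := by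
    intro M w a d
    have e1 : (Matrix.of fun i j => (a : ℝ) * (Matrix.of M * ((g⁻¹ : GL (Fin 4) ℝ) :
        Matrix (Fin 4) (Fin 4) ℝ)) i j) =
        (a : ℝ) • (Matrix.of M * ((g⁻¹ : GL (Fin 4) ℝ) : Matrix (Fin 4) (Fin 4) ℝ)) := by
      ext; simp
    have e2 : (fun i => (d : ℝ) * (g.1.mulVec w) i) = (d : ℝ) • g.1.mulVec w := by ext; simp
    have e3 : ((g⁻¹ : GL (Fin 4) ℝ) : Matrix (Fin 4) (Fin 4) ℝ) * g.1 = 1 := by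
      rw [← Units.val_mul, inv_mul_cancel, Units.val_one]
    have e4 : (Matrix.of fun i j => (a : ℝ) * (Matrix.of M * ((g⁻¹ : GL (Fin 4) ℝ) :
        Matrix (Fin 4) (Fin 4) ℝ)) i j).mulVec (fun i => (d : ℝ) * (g.1.mulVec w) i) =
        ((a : ℝ) * d) • (Matrix.of M).mulVec w := by
      rw [e1, e2, Matrix.smul_mulVec, Matrix.mulVec_smul, Matrix.mulVec_mulVec, Matrix.mul_assoc,
        e3, Matrix.mul_one, smul_smul]
    rw [e4]
    ext k
    simp only [proj, Pi.smul_apply, smul_eq_mul]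
    exact mul_div_mul_left _ _ (mul_ne_zero a.ne_zero d.ne_zero)
  funext i
  exact Prod.ext (key v.1 (v.2.2 i) a (c i)) (key v.2.1 (v.2.2 i) b (c i))

/-- The forward map `Φ : 𝒲 → 𝒳`. -/
def forward : WorldScene → ImageData ℝ :=
  Quotient.lift (fun v => forwardRep v.1) (by
    rintro u v ⟨g, a, b, c, h⟩
    rw [h, forwardRep_transform])

/-! ### The differential of the forward map and the ill-posed loci

`𝒲` is the quotient of an open subset of `Ambient` by the group `GL(4) × (ℝˣ)⁹` of
`SameScene`, with its quotient manifold structure. So its tangent space at the class of `v` is the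
quotient of `Ambient` by the tangent space at `v` of the orbit of `v`. -/

/-- The infinitesimal action at `v`: the derivative at `t = 0` of
`transform (exp (t A)) (exp (- t A)) (exp (t a)) (exp (t b)) (exp (t c)) v`. -/
def infinitesimalAction (v : Ambient) :
    Matrix (Fin 4) (Fin 4) ℝ × ℝ × ℝ × (Fin 7 → ℝ) →ₗ[ℝ] Ambient where
  toFun X := (fun i j => X.2.1 * v.1 i j - (Matrix.of v.1 * X.1) i j,
    fun i j => X.2.2.1 * v.2.1 i j - (Matrix.of v.2.1 * X.1) i j,
    fun k i => X.2.2.2 k * v.2.2 k i + X.1.mulVec (v.2.2 k) i)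
  map_add' X Y := by
    ext <;> simp [Matrix.mul_add, Matrix.add_mulVec] <;> ring
  map_smul' r X := by
    ext <;> simp [Matrix.smul_mulVec] <;> ring

/-- The tangent space at `v` of the orbit of `v`. -/
def orbitTangent (v : Ambient) : Submodule ℝ Ambient := LinearMap.range (infinitesimalAction v)

/-- The tangent space of `𝒲` at the class of `v`. -/
abbrev SceneTangent (v : {v : Ambient // IsScene v}) : Type := Ambient ⧸ orbitTangent v.1

lemma differentiableAt_forwardRep (v : {v : Ambient // IsScene v}) :
    DifferentiableAt ℝ forwardRep v.1 := by
  have key : ∀ (f : Ambient → Fin 3 → Fin 4 → ℝ) (_ : Differentiable ℝ f) (i : Fin 7),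
      (Matrix.of (f v.1)).mulVec (v.1.2.2 i) 2 ≠ 0 →
      DifferentiableAt ℝ (fun u : Ambient => proj ((Matrix.of (f u)).mulVec (u.2.2 i))) v.1 := by
    intro f hf i h0
    have hd : ∀ r, Differentiable ℝ
        (fun u : Ambient => (Matrix.of (f u)).mulVec (u.2.2 i) r) := by
      intro r
      simp only [Matrix.mulVec, dotProduct, Matrix.of_apply]
      fun_prop
    rw [differentiableAt_pi]
    intro c
    have h1 := (hd c.castSucc).differentiableAt (x := v.1)
    have h2 := (hd 2).differentiableAt (x := v.1)
    simp only [proj, div_eq_mul_inv]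
    exact h1.fun_mul (h2.fun_inv h0)
  unfold forwardRep
  rw [differentiableAt_pi]
  intro i
  exact (key (fun u => u.1) (by fun_prop) i (v.2.finite_fst i)).prodMk
    (key (fun u => u.2.1) (by fun_prop) i (v.2.finite_snd i))

lemma hasDerivAt_proj (M N : Fin 3 → Fin 4 → ℝ) (w z : Fin 4 → ℝ) (k : ℝ)
    (h : (Matrix.of N).mulVec w + (Matrix.of M).mulVec z = k • (Matrix.of M).mulVec w)
    (h0 : (Matrix.of M).mulVec w 2 ≠ 0) :
    HasDerivAt (fun s : ℝ => proj ((Matrix.of (M + s • N)).mulVec (w + s • z))) 0 0 := by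
  have hr : ∀ r, HasDerivAt (fun s : ℝ => (Matrix.of (M + s • N)).mulVec (w + s • z) r)
      (k * (Matrix.of M).mulVec w r) 0 := by
    intro r
    have e : (fun s : ℝ => (Matrix.of (M + s • N)).mulVec (w + s • z) r) = fun s : ℝ =>
        (Matrix.of M).mulVec w r + s * (k * (Matrix.of M).mulVec w r)
          + s ^ 2 * (Matrix.of N).mulVec z r := by
      funext s
      have h1 := congrFun h r
      simp only [Pi.add_apply, Pi.smul_apply, smul_eq_mul] at h1
      rw [← h1, ← Matrix.of_add_of, ← Matrix.smul_of, Matrix.add_mulVec, Matrix.mulVec_add,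
        Matrix.mulVec_add, Matrix.smul_mulVec, Matrix.mulVec_smul, Matrix.smul_mulVec,
        Matrix.mulVec_smul]
      simp only [Pi.add_apply, Pi.smul_apply, smul_eq_mul]
      ring
    rw [e]
    have := (((hasDerivAt_id (0 : ℝ)).mul_const (k * (Matrix.of M).mulVec w r)).const_add
      ((Matrix.of M).mulVec w r)).add (((hasDerivAt_id (0 : ℝ)).pow 2).mul_const
        ((Matrix.of N).mulVec z r))
    exact this.congr_deriv (by simp)
  rw [hasDerivAt_pi]
  intro c
  have := (hr c.castSucc).div (hr 2) (by simpa using h0)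
  refine this.congr_deriv ?_
  simp only [zero_smul, add_zero, Pi.zero_apply]
  rw [div_eq_zero_iff]
  left
  ring

lemma orbitTangent_le_ker (v : {v : Ambient // IsScene v}) :
    orbitTangent v.1 ≤ LinearMap.ker (fderiv ℝ forwardRep v.1).toLinearMap := by
  rintro _ ⟨⟨A, a, b, c⟩, rfl⟩
  set δ := infinitesimalAction v.1 (A, a, b, c) with hδ
  have hl : HasDerivAt (fun s : ℝ => v.1 + s • δ) δ 0 := by
    simpa using ((hasDerivAt_id (0 : ℝ)).smul_const δ).const_add v.1
  have h1 : HasDerivAt (fun s : ℝ => forwardRep (v.1 + s • δ)) (fderiv ℝ forwardRep v.1 δ) 0 := by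
    have hf : HasFDerivAt forwardRep (fderiv ℝ forwardRep v.1) (v.1 + (0 : ℝ) • δ) := by
      simpa using (differentiableAt_forwardRep v).hasFDerivAt
    exact hf.comp_hasDerivAt (0 : ℝ) hl
  have key : ∀ (M : Fin 3 → Fin 4 → ℝ) (w : Fin 4 → ℝ) (d e : ℝ),
      (Matrix.of fun i j => d * M i j - (Matrix.of M * A) i j).mulVec w +
        (Matrix.of M).mulVec (fun i => e * w i + A.mulVec w i) =
        (d + e) • (Matrix.of M).mulVec w := by
    intro M w d e
    have e1 : (Matrix.of fun i j => d * M i j - (Matrix.of M * A) i j) =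
        d • Matrix.of M - Matrix.of M * A := by ext; simp
    have e2 : (fun i => e * w i + A.mulVec w i) = e • w + A.mulVec w := by ext; simp
    rw [e1, e2, Matrix.sub_mulVec, Matrix.mulVec_add, Matrix.smul_mulVec, Matrix.mulVec_smul,
      Matrix.mulVec_mulVec, add_smul]
    abel
  have h2 : HasDerivAt (fun s : ℝ => forwardRep (v.1 + s • δ)) 0 0 := by
    rw [hasDerivAt_pi]
    intro i
    exact (hasDerivAt_proj _ _ _ _ _ (key v.1.1 (v.1.2.2 i) a (c i)) (v.2.finite_fst i)).prodMk
      (hasDerivAt_proj _ _ _ _ _ (key v.1.2.1 (v.1.2.2 i) b (c i)) (v.2.finite_snd i))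
  exact h1.unique h2

/-- The differential `DΦ(w) : T(𝒲, w) → T(𝒳, Φ(w)) = (ℝ² × ℝ²)⁷` at the class `w` of `v`. -/
def differentialForward (v : {v : Ambient // IsScene v}) : SceneTangent v →ₗ[ℝ] ImageData ℝ :=
  (orbitTangent v.1).liftQ (fderiv ℝ forwardRep v.1).toLinearMap (orbitTangent_le_ker v)

lemma range_fderiv_le (u v : {v : Ambient // IsScene v}) (h : u ≈ v) :
    LinearMap.range (differentialForward u) ≤ LinearMap.range (differentialForward v) := by
  obtain ⟨g, a, b, c, h⟩ := h
  set T := (transform g (g⁻¹ : GL (Fin 4) ℝ) a b (fun i => c i)).toContinuousLinearMap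
  have hT : v.1 = T u.1 := h
  have hc : forwardRep ∘ T = forwardRep := funext (forwardRep_transform g a b c)
  have hd : HasFDerivAt (forwardRep ∘ T) ((fderiv ℝ forwardRep v.1).comp T) u.1 := by
    refine HasFDerivAt.comp u.1 ?_ T.hasFDerivAt
    rw [← hT]
    exact (differentiableAt_forwardRep v).hasFDerivAt
  rw [hc] at hd
  simp only [differentialForward, Submodule.range_liftQ]
  rw [hd.fderiv]
  rintro _ ⟨y, rfl⟩
  exact ⟨T y, rfl⟩

/-- The rank of `DΦ(w)`. -/
def rankForward : WorldScene → ℕ :=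
  Quotient.lift (fun v => Module.finrank ℝ (LinearMap.range (differentialForward v)))
    fun u v h => by
      rw [(range_fderiv_le u v h).antisymm (range_fderiv_le v u (Setoid.symm h))]

/-- The ill-posed locus in `𝒲`: the world scenes at which `DΦ` is rank-deficient, that is, has
rank less than `dim 𝒲 = dim 𝒳 = 28`. -/
def illWorld : Set WorldScene := {w | rankForward w < 28}

/-- The ill-posed locus in `𝒳`. -/
def illImage : Set (ImageData ℝ) := forward '' illWorld

/-! ### Plücker coordinates and the epipolar constraints -/

/-- The 36 pairs `i < j` of indices in `{0, …, 8}`. -/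
abbrev PluckerIndex : Type := {p : Fin 9 × Fin 9 // p.1 < p.2}

/-- The entries of a `3 × 3` matrix, row by row. -/
def vec {R : Type} (F : Matrix (Fin 3) (Fin 3) R) (k : Fin 9) : R :=
  F ⟨k.1 / 3, by omega⟩ ⟨k.1 % 3, by omega⟩

/-- The (dual) Plücker coordinates of the span of `F₁` and `F₂` in `ℝ^{3 × 3} = ℝ⁹`:
the `2 × 2` minors of the matrix with rows `F₁`, `F₂`. -/
def pluckerOfSpan {R : Type} [CommRing R] (F₁ F₂ : Matrix (Fin 3) (Fin 3) R) (p : PluckerIndex) :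
    R :=
  vec F₁ p.1.1 * vec F₂ p.1.2 - vec F₁ p.1.2 * vec F₂ p.1.1

/-- `(γ; 1)`. -/
def homogenize {R : Type} [One R] (γ : Fin 2 → R) : Fin 3 → R := ![γ 0, γ 1, 1]

/-- The `7 × 9` matrix `L(x)` of the epipolar constraints: its `i`-th row sends `F` to
`(γ̄ᵢ; 1)ᵀ F (γᵢ; 1)`. -/
def epipolarMatrix {R : Type} [CommRing R] (x : ImageData R) : Matrix (Fin 7) (Fin 9) R :=
  Matrix.of fun i =>
    vec (Matrix.vecMulVec (homogenize (x i).2) (homogenize (x i).1))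

/-- The increasing enumeration of the elements of `{0, …, 8}` other than `i < j`. -/
def skip (p : PluckerIndex) (k : Fin 7) : Fin 9 :=
  p.1.2.succAbove
    ((⟨p.1.1.1, by have := p.2; omega⟩ : Fin 8).succAbove k)

/-- The Plücker coordinates of the kernel of a `7 × 9` matrix: the maximal minor that omits the
columns `i < j`, with the sign `(-1)^(i + j)`, by which the maximal minors of `L` and the
`2 × 2` minors of a basis of `ker L` agree up to a common factor. -/
def pluckerOfKer {R : Type} [CommRing R] (L : Matrix (Fin 7) (Fin 9) R) (p : PluckerIndex) : R :=
  (-1) ^ (p.1.1.1 + p.1.2.1) * (L.submatrix id (skip p)).det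

/-- A polynomial `P` in the Plücker coordinates, as a polynomial in the 28 entries of the image
data `x`: the value of `P` at the Plücker coordinates of `ker L(x)`. -/
def inImageData (P : MvPolynomial PluckerIndex ℤ) : MvPolynomial (Fin 7 × Fin 2 × Fin 2) ℤ :=
  MvPolynomial.aeval (pluckerOfKer (epipolarMatrix genericImageData)) P

/-- The degree of a polynomial in the two coordinates of one image point: the `i`-th point in the
first (`s = 0`) or second (`s = 1`) image. -/
def degreeInPoint (D : MvPolynomial (Fin 7 × Fin 2 × Fin 2) ℤ) (i : Fin 7) (s : Fin 2) : ℕ :=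
  D.support.sup fun m => m (i, s, 0) + m (i, s, 1)

/-! ### The discriminant of a pencil -/

open Polynomial in
/-- The polynomial `det(t F₁ + F₂)` in `t`. -/
def pencilDet (F₁ F₂ : Matrix (Fin 3) (Fin 3) ℝ) : ℝ[X] :=
  ((X : ℝ[X]) • F₁.map C + F₂.map C).det

/-- The discriminant `b²c² - 4ac³ - 4b³d - 27a²d² + 18abcd` of
`det(t F₁ + F₂) = a t³ + b t² + c t + d`, as a cubic (also where `a = 0`). -/
def pencilDiscr (F₁ F₂ : Matrix (Fin 3) (Fin 3) ℝ) : ℝ :=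
  (⟨(pencilDet F₁ F₂).coeff 3, (pencilDet F₁ F₂).coeff 2, (pencilDet F₁ F₂).coeff 1,
    (pencilDet F₁ F₂).coeff 0⟩ : Cubic ℝ).discr

end

end SevenPoint

/-! A change of basis of the pencil multiplies the discriminant of `det (t F₁ + F₂)` by the sixth
power of its determinant. The discriminant is therefore an SL₂-invariant of two vectors in ℝ⁹, and
classical invariant theory writes it as a form of degree 6 in their `2 × 2` minors. Subduction finds
this form as a combination of standard monomials. One kernel computation carries it out, checks that
the remainder is zero, and inspects the terms (`isComplete_discrSubduction`). The computation stays
small because the pencil is normalized by two vanishing entries and all variables are replaced by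
powers of a single `T`. This substitution is injective in the degrees that occur, and GL₂-covariance
removes the normalization (`aeval_bracket_discrPolynomial`).

By Cramer's rule the signed maximal minors of a `7 × 9` matrix `L` are proportional to the `2 × 2`
minors of any two kernel vectors (`skewMinor_mul_bracket`). So the form vanishes at the minors of
`L` as soon as two independent kernel elements span a pencil with discriminant zero.

Each maximal minor of the epipolar matrix is affine in each image point, so the degree in a point is
at most 6. The part of degree 6 is the form evaluated after one row is replaced by its linear part,
and an explicit configuration shows that this is nonzero.

For ill-posed scenes, take the cameras to be `[I | 0]` and `[M | m]`, with fundamental matrix `F =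
[m]ₓ M` in `ker L`. A first-order deformation that fixes the images yields a derivative `F'` of the
fundamental matrix which also lies in `ker L` and is tangent to `det = 0` at `F`. Then `det (t F +
F')` has no cubic and no quadratic term, and its discriminant is zero. If `F'` is a multiple of `F`,
the deformation is an infinitesimal change of coordinates, unless a world point lies on the
baseline. In that case every element of `ker L` is tangent to `det = 0` at `F`, so the form vanishes
again (`deformation_trivial_of_discr_ne_zero`). -/

/-! ### Sparse univariate polynomials

Integer polynomials in one variable `T` as lists of terms in order of decreasing exponents. The
operations are written with recursors and with the primitive operations of `ℕ` and `ℤ`, so that the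
kernel evaluates them quickly. -/

/-- A list of terms `a T ^ d`. -/
inductive SparsePoly where
  | zero : SparsePoly
  | term (d : ℕ) (a : ℤ) (p : SparsePoly) : SparsePoly

noncomputable section

namespace SparsePoly

open Polynomial

/-- The polynomial with the given terms. -/
def toPoly : SparsePoly → ℤ[X]
  | zero => 0
  | term d a p => monomial d a + toPoly p

/-- `a T ^ d + p`, where the first term is left out if `a = 0`. -/
def termOrSkip (d : ℕ) (a : ℤ) (p : SparsePoly) : SparsePoly :=
  Int.rec (fun n => Nat.rec p (fun m _ => term d (Int.ofNat (Nat.succ m)) p) n)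
    (fun n => term d (Int.negSucc n) p) a

/-- `b T ^ k p + q`. -/
def addMul (k : ℕ) (b : ℤ) (p : SparsePoly) : SparsePoly → SparsePoly :=
  SparsePoly.rec (fun q => q)
    (fun d a _ addTail q =>
      SparsePoly.rec (term (Nat.add d k) (Int.mul b a) (addTail zero))
        (fun e c q' addTailRight =>
          Bool.rec
            (Bool.rec (term e c addTailRight)
              (termOrSkip e (Int.add (Int.mul b a) c) (addTail q'))
              (Nat.beq (Nat.add d k) e))
            (term (Nat.add d k) (Int.mul b a) (addTail (term e c q')))
            (Nat.ble (Nat.succ e) (Nat.add d k))) q) p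

/-- The sum of two polynomials. -/
def add (p q : SparsePoly) : SparsePoly := addMul 0 1 p q

/-- The multiple of a polynomial by an integer. -/
def smul (b : ℤ) (p : SparsePoly) : SparsePoly := addMul 0 b p zero

/-- The product of two polynomials. -/
def mul (p q : SparsePoly) : SparsePoly :=
  SparsePoly.rec zero (fun d a _ ih => addMul d a q ih) p

/-- `T ^ d`. -/
def power (d : ℕ) : SparsePoly := term d 1 zero

lemma toPoly_termOrSkip (d : ℕ) (a : ℤ) (p : SparsePoly) :
    toPoly (termOrSkip d a p) = monomial d a + toPoly p := by
  match a with
  | Int.ofNat 0 => simp [termOrSkip]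
  | Int.ofNat (n + 1) => rfl
  | Int.negSucc n => rfl

/-- The terms need not be sorted. The comparison of exponents only decides which terms are merged,
and the value is correct in every branch. -/
lemma toPoly_addMul (k : ℕ) (b : ℤ) (p q : SparsePoly) :
    toPoly (addMul k b p q) = monomial k b * toPoly p + toPoly q := by
  induction p generalizing q with
  | zero => simp [addMul, toPoly]
  | term d a p ihp =>
    induction q with
    | zero =>
      have : addMul k b (term d a p) zero = term (d + k) (b * a) (addMul k b p zero) := rfl
      simp only [this, toPoly, ihp, mul_add, monomial_mul_monomial, add_comm d k, add_zero]
    | term e c q ihq =>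
      have : addMul k b (term d a p) (term e c q) = Bool.rec
            (Bool.rec (term e c (addMul k b (term d a p) q))
              (termOrSkip e (b * a + c) (addMul k b p q))
              (Nat.beq (d + k) e))
            (term (d + k) (b * a) (addMul k b p (term e c q)))
            (Nat.ble (Nat.succ e) (d + k)) := rfl
      rw [this]
      have hm : monomial k b * toPoly (term d a p) =
          monomial (d + k) (b * a) + monomial k b * toPoly p := by
        rw [toPoly, mul_add, monomial_mul_monomial, add_comm d k]
      rw [hm] at ihq ⊢
      cases Nat.ble (Nat.succ e) (d + k) with
      | true =>
        simp only [toPoly, ihp]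
        abel
      | false =>
        cases h : Nat.beq (d + k) e with
        | true =>
          simp only [toPoly_termOrSkip, ihp, toPoly, Nat.eq_of_beq_eq_true h, map_add]
          abel
        | false =>
          simp only [toPoly, ihq]
          abel

@[simp] lemma toPoly_add (p q : SparsePoly) : toPoly (add p q) = toPoly p + toPoly q := by
  rw [add, toPoly_addMul, monomial_zero_one, one_mul]

@[simp] lemma toPoly_smul (b : ℤ) (p : SparsePoly) : toPoly (smul b p) = C b * toPoly p := by
  rw [smul, toPoly_addMul, monomial_zero_left, toPoly, add_zero]

@[simp] lemma toPoly_mul (p q : SparsePoly) : toPoly (mul p q) = toPoly p * toPoly q := by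
  induction p with
  | zero => simp [mul, toPoly]
  | term d a p ih =>
    have : mul (term d a p) q = addMul d a q (mul p q) := rfl
    rw [this, toPoly_addMul, ih, toPoly, add_mul]

@[simp] lemma toPoly_power (d : ℕ) : toPoly (power d) = X ^ d := by
  rw [power, toPoly, toPoly, add_zero, monomial_one_right_eq_X_pow]

/-- Whether the list of terms is empty. -/
def isZero (p : SparsePoly) : Bool := SparsePoly.rec true (fun _ _ _ _ => false) p

lemma toPoly_of_isZero {p : SparsePoly} (h : p.isZero = true) : p.toPoly = 0 := by
  cases p with
  | zero => rfl
  | term => cases h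

end SparsePoly

namespace SevenPoint

/-! ### The discriminant of a pencil of `3 × 3` matrices -/

section Pencil

variable {R : Type*} [CommRing R]

/-- The polarization of the determinant of a `3 × 3` matrix, as a sum over permutations of the
values `f i j k` on triples of positions. -/
def detSum (f : Fin 9 → Fin 9 → Fin 9 → R) : R :=
  f 0 4 8 + f 1 5 6 + f 2 3 7 - f 0 5 7 - f 1 3 8 - f 2 4 6

/-- The coefficients of `det (t x + y)`, where `x` and `y` are `3 × 3` matrices listed row by
row. -/
def pencilCubic (x y : Fin 9 → R) : Cubic R where
  a := detSum fun i j k => x i * x j * x k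
  b := detSum fun i j k => x i * x j * y k + x i * y j * x k + y i * x j * x k
  c := detSum fun i j k => x i * y j * y k + y i * x j * y k + y i * y j * x k
  d := detSum fun i j k => y i * y j * y k

/-- The `2 × 2` minors of the matrix with rows `x` and `y`. -/
def bracket (x y : Fin 9 → R) (i j : Fin 9) : R := x i * y j - x j * y i

end Pencil

/-! ### The Kronecker substitution

A monomial `∏ x i ^ m i * ∏ y i ^ n i` of degree less than `16` is encoded by the number with the
digits `n 0, …, n 8, m 0 + n 0, …, m 8 + n 8` in base `16`. The variables `x 8` and `y 0` are
set to zero. -/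

/-- `16 ^ 9`. -/
def weightUnit : ℕ := 16 ^ 9

/-- The exponent of `T` that is substituted for `x i`. -/
def weightX (i : ℕ) : ℕ := Nat.mul weightUnit (Nat.pow 16 i)

/-- The exponent of `T` that is substituted for `y i`. -/
def weightY (i : ℕ) : ℕ := Nat.mul (Nat.succ weightUnit) (Nat.pow 16 i)

/-- The value of `x i` under the substitution. -/
def sparseX (i : ℕ) : SparsePoly := Bool.rec (.power (weightX i)) .zero (Nat.beq i 8)

/-- The value of `y i` under the substitution. -/
def sparseY (i : ℕ) : SparsePoly := Bool.rec (.power (weightY i)) .zero (Nat.beq i 0)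

/-- The value of the bracket `[i j]` under the substitution. -/
def sparseBracket (e : ℕ × ℕ) : SparsePoly :=
  ((sparseX e.1).mul (sparseY e.2)).add (((sparseX e.2).mul (sparseY e.1)).smul (-1))

/-- The value of a product of brackets under the substitution. -/
def sparseProd (l : List (ℕ × ℕ)) : SparsePoly :=
  List.rec (.power 0) (fun e _ ih => (sparseBracket e).mul ih) l

/-- The value of `detSum f` under the substitution. -/
def sparseDetSum (f : ℕ → ℕ → ℕ → SparsePoly) : SparsePoly :=
  (f 0 4 8).add <| (f 1 5 6).add <| (f 2 3 7).add <|
    .smul (-1) <| (f 0 5 7).add <| (f 1 3 8).add (f 2 4 6)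

/-- The value of the leading coefficient of the cubic of a pencil under the substitution. -/
def sparseA : SparsePoly :=
  sparseDetSum fun i j k => (sparseX i).mul ((sparseX j).mul (sparseX k))

/-- The value of the second coefficient of the cubic of a pencil under the substitution. -/
def sparseB : SparsePoly := sparseDetSum fun i j k =>
  ((sparseX i).mul ((sparseX j).mul (sparseY k))).add <|
    ((sparseX i).mul ((sparseY j).mul (sparseX k))).add <|
      (sparseY i).mul ((sparseX j).mul (sparseX k))

/-- The value of the third coefficient of the cubic of a pencil under the substitution. -/
def sparseC : SparsePoly := sparseDetSum fun i j k =>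
  ((sparseX i).mul ((sparseY j).mul (sparseY k))).add <|
    ((sparseY i).mul ((sparseX j).mul (sparseY k))).add <|
      (sparseY i).mul ((sparseY j).mul (sparseX k))

/-- The value of the constant coefficient of the cubic of a pencil under the substitution. -/
def sparseD : SparsePoly :=
  sparseDetSum fun i j k => (sparseY i).mul ((sparseY j).mul (sparseY k))

/-- The value of the discriminant of a pencil under the substitution. -/
def sparseDiscr : SparsePoly :=
  (sparseC.mul (sparseC.mul ((sparseB.mul sparseB).add ((sparseA.smul (-4)).mul sparseC)))).add
    (sparseD.mul ((sparseB.mul (((sparseA.smul 18).mul sparseC).add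
      ((sparseB.smul (-4)).mul sparseB))).add ((sparseA.smul (-27)).mul (sparseA.mul sparseD))))

/-! ### Subduction

The leading monomials of the standard monomials `[i₁ j₁] ⋯ [iₖ jₖ]`, where `i₁ ≤ ⋯ ≤ iₖ` and
`j₁ ≤ ⋯ ≤ jₖ`, are the monomials `x i₁ ⋯ x iₖ y j₁ ⋯ y jₖ`. So an invariant is written as a linear
combination of standard monomials by repeatedly subtracting the multiple of the standard monomial
that has the same leading term. -/

/-- The list with `d` entries `i` for each of the digits `d` of `c` in base `16`, where `i` is the
position of the digit. -/
def digitList (c : ℕ) : List ℕ :=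
  List.rec (fun _ => [])
    (fun i _ ih c => Nat.rec (ih (Nat.div c 16)) (fun _ r => i :: r) (Nat.mod c 16))
    [0, 1, 2, 3, 4, 5, 6, 7, 8] c

/-- The brackets of the standard monomial with the given leading monomial. -/
def standardBrackets (c : ℕ) : List (ℕ × ℕ) :=
  List.zip (digitList (Nat.sub (Nat.div c weightUnit) (Nat.mod c weightUnit)))
    (digitList (Nat.mod c weightUnit))

/-- At most `n` steps of the subduction of a polynomial: the list of the standard monomials and of
their coefficients, and the remainder. -/
def subduct (n : ℕ) : SparsePoly → List (List (ℕ × ℕ) × ℤ) × SparsePoly :=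
  Nat.rec (fun p => ([], p))
    (fun _ ih p => SparsePoly.rec ([], .zero)
      (fun d a _ _ =>
        let l := standardBrackets d
        let r := ih (.addMul 0 (-a) (sparseProd l) p)
        ((l, a) :: r.1, r.2)) p) n

/-- The result of the subduction of the discriminant. -/
def discrSubduction : List (List (ℕ × ℕ) × ℤ) × SparsePoly := subduct 2000 sparseDiscr

/-- The terms of the discriminant in the brackets. -/
def discrTerms : List (List (ℕ × ℕ) × ℤ) := discrSubduction.1

/-- The exponent of the leading monomial of a standard monomial. -/
def leadingWeight (l : List (ℕ × ℕ)) : ℕ :=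
  (l.map fun e => weightX e.1 + weightY e.2).sum

/-- A term of degree `6` in brackets `[i j]` with `i < j ≤ 8`, with a nonzero coefficient of
absolute value at most `72`. -/
def IsGoodTerm (t : List (ℕ × ℕ) × ℤ) : Prop :=
  t.1.length = 6 ∧ (∀ e ∈ t.1, e.1 < e.2 ∧ e.2 < 9) ∧ t.2 ≠ 0 ∧ t.2.natAbs ≤ 72

instance : DecidablePred IsGoodTerm := fun t => by unfold IsGoodTerm; infer_instance

/-- Whether all terms of a list are good, in order of decreasing weights below `n`. -/
def goodTerms : ℕ → List (List (ℕ × ℕ) × ℤ) → Bool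
  | _, [] => true
  | n, t :: r => decide (IsGoodTerm t) && Nat.ble (leadingWeight t.1 + 1) n &&
      goodTerms (leadingWeight t.1) r

/-- Whether the result of a subduction consists of `1668` good terms and the remainder zero. -/
def isComplete (r : List (List (ℕ × ℕ) × ℤ) × SparsePoly) : Bool :=
  r.2.isZero && (Nat.beq r.1.length 1668 && goodTerms (16 ^ 19) r.1)

-- The one large computation. The bound of 2000 steps in `discrSubduction` is only fuel: the
-- remainder reaches zero after 1668 steps. The bound `16 ^ 19` in `isComplete` exceeds the weight
-- of every product of six brackets.
set_option maxHeartbeats 0 in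
lemma isComplete_discrSubduction : isComplete discrSubduction = true := by
  decide +kernel

lemma isComplete_iff {r : List (List (ℕ × ℕ) × ℤ) × SparsePoly} : isComplete r = true ↔
    r.2.isZero = true ∧ r.1.length = 1668 ∧ goodTerms (16 ^ 19) r.1 = true := by
  rw [isComplete, Bool.and_eq_true, Bool.and_eq_true, Nat.beq_eq]

end SevenPoint
end

/-! ### The discriminant form and its monomials -/

noncomputable section
namespace SevenPoint

lemma discrTerms_length : discrTerms.length = 1668 :=
  (isComplete_iff.1 isComplete_discrSubduction).2.1

lemma isGoodTerm_and_pairwise_of_goodTerms {n : ℕ} {r : List (List (ℕ × ℕ) × ℤ)}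
    (h : goodTerms n r = true) : (∀ t ∈ r, IsGoodTerm t ∧ leadingWeight t.1 < n) ∧
      r.Pairwise fun t t' => leadingWeight t'.1 < leadingWeight t.1 := by
  induction r generalizing n with
  | nil => simp
  | cons t r ih =>
    simp only [goodTerms, Bool.and_eq_true, decide_eq_true_eq] at h
    obtain ⟨⟨h1, h2⟩, h3⟩ := h
    have h2 : leadingWeight t.1 < n := Nat.le_of_ble_eq_true h2
    obtain ⟨ih1, ih2⟩ := ih h3
    refine ⟨?_, List.pairwise_cons.2 ⟨fun t' ht' => (ih1 t' ht').2, ih2⟩⟩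
    rintro t' (_ | ⟨_, ht'⟩)
    · exact ⟨h1, h2⟩
    · exact ⟨(ih1 t' ht').1, (ih1 t' ht').2.trans h2⟩

lemma goodTerms_discrTerms : goodTerms (16 ^ 19) discrTerms = true :=
  (isComplete_iff.1 isComplete_discrSubduction).2.2

lemma isGoodTerm_of_mem {t : List (ℕ × ℕ) × ℤ} (h : t ∈ discrTerms) : IsGoodTerm t :=
  ((isGoodTerm_and_pairwise_of_goodTerms goodTerms_discrTerms).1 t h).1

/-- The index of the Plücker coordinate `[i j]`. -/
def toIndex (e : ℕ × ℕ) : PluckerIndex :=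
  if h : e.1 < e.2 ∧ e.2 < 9 then ⟨(⟨e.1, h.1.trans h.2⟩, ⟨e.2, h.2⟩), h.1⟩ else ⟨(0, 1), by decide⟩

lemma toIndex_fst {e : ℕ × ℕ} (h : e.1 < e.2 ∧ e.2 < 9) : ((toIndex e).1.1 : ℕ) = e.1 := by
  simp [toIndex, h]

lemma toIndex_snd {e : ℕ × ℕ} (h : e.1 < e.2 ∧ e.2 < 9) : ((toIndex e).1.2 : ℕ) = e.2 := by
  simp [toIndex, h]

/-- The exponents of a product of Plücker coordinates. -/
def pluckerExponents (l : List (ℕ × ℕ)) : PluckerIndex →₀ ℕ :=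
  (l.map fun e => Finsupp.single (toIndex e) 1).sum

open MvPolynomial in
/-- A linear combination of products of Plücker coordinates. -/
def ofTerms (r : List (List (ℕ × ℕ) × ℤ)) : MvPolynomial PluckerIndex ℤ :=
  (r.map fun t => monomial (pluckerExponents t.1) t.2).sum

/-- The discriminant of a pencil of `3 × 3` matrices, as a linear combination of standard
monomials in the Plücker coordinates of the pencil. -/
def discrPolynomial : MvPolynomial PluckerIndex ℤ := ofTerms discrTerms

/-- The exponent of the leading monomial of a product of Plücker coordinates. -/
def exponentWeight : (PluckerIndex →₀ ℕ) →+ ℕ :=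
  Finsupp.liftAddHom fun p => AddMonoidHom.mulRight (weightX p.1.1 + weightY p.1.2)

lemma exponentWeight_pluckerExponents {l : List (ℕ × ℕ)}
    (h : ∀ e ∈ l, e.1 < e.2 ∧ e.2 < 9) :
    exponentWeight (pluckerExponents l) = leadingWeight l := by
  rw [pluckerExponents, map_list_sum, leadingWeight, List.map_map]
  congr 1
  refine List.map_congr_left fun e he => ?_
  simp [exponentWeight, toIndex_fst (h e he), toIndex_snd (h e he)]

/-- The leading weight depends only on the exponent vector, so strictly decreasing weights force
distinct monomials. Hence no terms of the list merge or cancel, and the number of terms and the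
coefficients can be read off the list. -/
lemma pairwise_pluckerExponents_ne :
    discrTerms.Pairwise fun t t' => pluckerExponents t.1 ≠ pluckerExponents t'.1 := by
  refine (isGoodTerm_and_pairwise_of_goodTerms goodTerms_discrTerms).2.imp_of_mem ?_
  intro t t' ht ht' h e
  rw [← exponentWeight_pluckerExponents (isGoodTerm_of_mem ht).2.1,
    ← exponentWeight_pluckerExponents (isGoodTerm_of_mem ht').2.1, e] at h
  exact h.false

open MvPolynomial

lemma coeff_ofTerms_eq_zero {r : List (List (ℕ × ℕ) × ℤ)} {m : PluckerIndex →₀ ℕ}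
    (h : ∀ t ∈ r, pluckerExponents t.1 ≠ m) : (ofTerms r).coeff m = 0 := by
  induction r with
  | nil => simp [ofTerms]
  | cons t r ih =>
    simp only [List.mem_cons, forall_eq_or_imp] at h
    have := ih h.2
    simp_all [ofTerms, coeff_monomial]

lemma coeff_ofTerms {r : List (List (ℕ × ℕ) × ℤ)}
    (h : r.Pairwise fun t t' => pluckerExponents t.1 ≠ pluckerExponents t'.1)
    {t : List (ℕ × ℕ) × ℤ} (ht : t ∈ r) : (ofTerms r).coeff (pluckerExponents t.1) = t.2 := by
  induction r with
  | nil => cases ht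
  | cons t' r ih =>
    rw [List.pairwise_cons] at h
    have e : ofTerms (t' :: r) = monomial (pluckerExponents t'.1) t'.2 + ofTerms r := rfl
    rw [e, coeff_add, coeff_monomial]
    rcases List.mem_cons.1 ht with rfl | ht
    · rw [if_pos rfl, coeff_ofTerms_eq_zero fun s hs => (h.1 s hs).symm, add_zero]
    · rw [if_neg (h.1 t ht), zero_add, ih h.2 ht]

lemma support_discrPolynomial :
    discrPolynomial.support = (discrTerms.map fun t => pluckerExponents t.1).toFinset := by
  ext m
  simp only [mem_support_iff, List.mem_toFinset, List.mem_map]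
  constructor
  · intro h
    by_contra! h'
    exact h (coeff_ofTerms_eq_zero h')
  · rintro ⟨t, ht, rfl⟩
    rw [discrPolynomial, coeff_ofTerms pairwise_pluckerExponents_ne ht]
    exact (isGoodTerm_of_mem ht).2.2.1

lemma card_support_discrPolynomial : discrPolynomial.support.card = 1668 := by
  rw [support_discrPolynomial, List.toFinset_card_of_nodup, List.length_map, discrTerms_length]
  exact List.pairwise_map.2 pairwise_pluckerExponents_ne

lemma abs_coeff_discrPolynomial_le (m : PluckerIndex →₀ ℕ) : |discrPolynomial.coeff m| ≤ 72 := by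
  by_cases h : ∃ t ∈ discrTerms, pluckerExponents t.1 = m
  · obtain ⟨t, ht, rfl⟩ := h
    rw [discrPolynomial, coeff_ofTerms pairwise_pluckerExponents_ne ht]
    have := (isGoodTerm_of_mem ht).2.2.2
    rw [Int.abs_eq_natAbs]
    exact_mod_cast this
  · push Not at h
    simp [discrPolynomial, coeff_ofTerms_eq_zero h]

lemma degree_pluckerExponents (l : List (ℕ × ℕ)) : (pluckerExponents l).degree = l.length := by
  rw [pluckerExponents, map_list_sum, List.map_map]
  simp [Function.comp_def]

lemma isHomogeneous_discrPolynomial : discrPolynomial.IsHomogeneous 6 := by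
  have : ∀ t ∈ discrTerms, monomial (pluckerExponents t.1) t.2 ∈
      homogeneousSubmodule PluckerIndex ℤ 6 := fun t ht => by
    refine isHomogeneous_monomial _ ?_
    rw [degree_pluckerExponents, (isGoodTerm_of_mem ht).1]
  refine (homogeneousSubmodule PluckerIndex ℤ 6).list_sum_mem ?_
  simpa using fun t l a h e => e ▸ this (l, a) h

/-- The value of a linear combination of products of Plücker coordinates. -/
lemma aeval_ofTerms {R : Type*} [CommRing R] [Algebra ℤ R] (f : PluckerIndex → R)
    (r : List (List (ℕ × ℕ) × ℤ)) : aeval f (ofTerms r) =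
      (r.map fun t => (t.2 : R) * (t.1.map fun e => f (toIndex e)).prod).sum := by
  rw [ofTerms, map_list_sum, List.map_map]
  congr 1
  refine List.map_congr_left fun t _ => ?_
  have (l : List (ℕ × ℕ)) : monomial (pluckerExponents l) (1 : ℤ) =
      (l.map fun e => X (toIndex e)).prod := by
    induction l with
    | nil => simp [pluckerExponents]
    | cons e l ih =>
      rw [List.map_cons, List.prod_cons, ← ih, X, monomial_mul, one_mul]
      simp [pluckerExponents]
  rw [Function.comp_apply, ← mul_one t.2, ← C_mul_monomial, this, map_mul, map_list_prod,
    List.map_map, mul_one]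
  simp [Function.comp_def]

end SevenPoint
end

/-! ### The discriminant identity after the Kronecker substitution -/

noncomputable section
namespace SevenPoint

open MvPolynomial SparsePoly

/-- The substitution in `ℤ[T]` at which `sparseX` evaluates `x`. -/
def kroneckerX (i : Fin 9) : Polynomial ℤ := (sparseX i).toPoly

/-- The substitution in `ℤ[T]` at which `sparseY` evaluates `y`. -/
def kroneckerY (i : Fin 9) : Polynomial ℤ := (sparseY i).toPoly

lemma toPoly_sparseDetSum (f : ℕ → ℕ → ℕ → SparsePoly) :
    (sparseDetSum f).toPoly = detSum fun i j k => (f i j k).toPoly := by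
  simp only [sparseDetSum, toPoly_add, toPoly_smul, map_neg, map_one, detSum]
  ring_nf
  rfl

lemma toPoly_sparseDiscr :
    sparseDiscr.toPoly = (pencilCubic kroneckerX kroneckerY).discr := by
  have ha : sparseA.toPoly = (pencilCubic kroneckerX kroneckerY).a := by
    simp only [sparseA, toPoly_sparseDetSum, toPoly_mul, ← mul_assoc]
    rfl
  have hb : sparseB.toPoly = (pencilCubic kroneckerX kroneckerY).b := by
    simp only [sparseB, toPoly_sparseDetSum, toPoly_mul, toPoly_add, ← mul_assoc, ← add_assoc]
    rfl
  have hc : sparseC.toPoly = (pencilCubic kroneckerX kroneckerY).c := by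
    simp only [sparseC, toPoly_sparseDetSum, toPoly_mul, toPoly_add, ← mul_assoc, ← add_assoc]
    rfl
  have hd : sparseD.toPoly = (pencilCubic kroneckerX kroneckerY).d := by
    simp only [sparseD, toPoly_sparseDetSum, toPoly_mul, ← mul_assoc]
    rfl
  simp only [sparseDiscr, toPoly_add, toPoly_mul, toPoly_smul, ha, hb, hc, hd, Cubic.discr,
    Polynomial.C_neg, Polynomial.C_ofNat]
  ring

/-- Each step moves a multiple of a product of brackets from the polynomial to the list, whatever
that product is. Thus the choice of leading terms needs no justification: once the remainder is
zero, the identity is proved. -/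
lemma toPoly_eq_sum_subduct (n : ℕ) (p : SparsePoly) : p.toPoly =
    ((subduct n p).1.map fun t => (t.2 : Polynomial ℤ) * (sparseProd t.1).toPoly).sum +
      (subduct n p).2.toPoly := by
  induction n generalizing p with
  | zero => simp [subduct]
  | succ n ih =>
    cases p with
    | zero => simp [subduct]
    | term d a p =>
      have e : subduct (n + 1) (term d a p) =
          ((standardBrackets d, a) ::
            (subduct n (addMul 0 (-a) (sparseProd (standardBrackets d)) (term d a p))).1,
          (subduct n (addMul 0 (-a) (sparseProd (standardBrackets d)) (term d a p))).2) := rfl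
      rw [e, List.map_cons, List.sum_cons, add_assoc, ← ih, toPoly_addMul,
        Polynomial.monomial_zero_left]
      simp

lemma toPoly_sparseProd {l : List (ℕ × ℕ)} (h : ∀ e ∈ l, e.1 < e.2 ∧ e.2 < 9) :
    (sparseProd l).toPoly = (l.map fun e =>
      bracket kroneckerX kroneckerY (toIndex e).1.1 (toIndex e).1.2).prod := by
  induction l with
  | nil => simp [sparseProd]
  | cons e l ih =>
    simp only [List.mem_cons, forall_eq_or_imp] at h
    have : sparseProd (e :: l) = (sparseBracket e).mul (sparseProd l) := rfl
    rw [this, toPoly_mul, ih h.2, List.map_cons, List.prod_cons]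
    congr 1
    simp only [sparseBracket, toPoly_add, toPoly_mul, toPoly_smul, bracket, kroneckerX,
      kroneckerY, toIndex_fst h.1, toIndex_snd h.1, map_neg, map_one]
    ring

lemma toPoly_eq_sum_of_isComplete {n : ℕ} {p : SparsePoly}
    {r : List (List (ℕ × ℕ) × ℤ) × SparsePoly} (hr : subduct n p = r) (h : isComplete r = true) :
    p.toPoly = (r.1.map fun t => (t.2 : Polynomial ℤ) * (sparseProd t.1).toPoly).sum := by
  rw [toPoly_eq_sum_subduct n p, hr, toPoly_of_isZero (isComplete_iff.1 h).1, add_zero]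

lemma toPoly_sparseDiscr_eq_sum : sparseDiscr.toPoly =
    (discrTerms.map fun t => (t.2 : Polynomial ℤ) * (sparseProd t.1).toPoly).sum :=
  toPoly_eq_sum_of_isComplete (n := 2000) rfl isComplete_discrSubduction

lemma aeval_kronecker_discrPolynomial :
    aeval (fun p : PluckerIndex => bracket kroneckerX kroneckerY p.1.1 p.1.2) discrPolynomial =
      (pencilCubic kroneckerX kroneckerY).discr := by
  rw [← toPoly_sparseDiscr, toPoly_sparseDiscr_eq_sum, discrPolynomial, aeval_ofTerms]
  refine congrArg List.sum (List.map_congr_left fun t ht => ?_)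
  rw [toPoly_sparseProd (isGoodTerm_of_mem ht).2.1]

/-! ### Injectivity of the Kronecker substitution -/

/-- The exponent of `T` that is substituted for a variable. -/
def kroneckerWeight : Fin 9 ⊕ Fin 9 → ℕ := Sum.elim (fun i => weightX i) fun i => weightY i

lemma linearCombination_kroneckerWeight (m : Fin 9 ⊕ Fin 9 →₀ ℕ) :
    Finsupp.linearCombination ℕ kroneckerWeight m =
      Nat.ofDigits 16 ((List.ofFn fun i => m (.inr i)) ++
        List.ofFn fun i => m (.inl i) + m (.inr i)) := by
  rw [Finsupp.linearCombination_apply, Finsupp.sum_fintype _ _ (by simp), Fintype.sum_sum_type]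
  simp only [kroneckerWeight, Sum.elim_inl, Sum.elim_inr, smul_eq_mul, weightX, weightY,
    weightUnit, Nat.mul_eq, Nat.pow_eq, Fin.sum_univ_succ, List.ofFn_succ, List.ofFn_zero,
    List.cons_append, List.nil_append, Nat.ofDigits_cons, Nat.ofDigits_nil]
  norm_num [Fin.sum_univ_succ, Fin.succ]
  ring

/-- Below degree 16 every digit is less than the base, so base-16 expansions are unique. The low
digits give the exponents of `y`, and subtracting them from the high digits gives those of `x`. -/
lemma kroneckerWeight_injOn : Set.InjOn (Finsupp.linearCombination ℕ kroneckerWeight)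
    {m | m.degree < 16} := by
  intro m hm n hn h
  rw [linearCombination_kroneckerWeight, linearCombination_kroneckerWeight] at h
  have key : ∀ m : Fin 9 ⊕ Fin 9 →₀ ℕ, m.degree < 16 → ∀ d ∈ (List.ofFn fun i => m (.inr i)) ++
        List.ofFn fun i => m (.inl i) + m (.inr i), d < 16 := by
    intro m hm d hd
    have hs (v) : m v ≤ m.degree := Finsupp.le_degree v m
    have hs : m.degree = ∑ i, m (.inl i) + ∑ i, m (.inr i) := by
      rw [Finsupp.degree_eq_sum, Fintype.sum_sum_type]
    have h1 (i : Fin 9) : m (.inl i) ≤ ∑ i, m (.inl i) :=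
      Finset.single_le_sum (f := fun i => m (.inl i)) (fun _ _ => zero_le) (Finset.mem_univ i)
    have h2 (i : Fin 9) : m (.inr i) ≤ ∑ i, m (.inr i) :=
      Finset.single_le_sum (f := fun i => m (.inr i)) (fun _ _ => zero_le) (Finset.mem_univ i)
    simp only [List.mem_append, List.mem_ofFn] at hd
    rcases hd with ⟨i, rfl⟩ | ⟨i, rfl⟩
    · have := h2 i
      omega
    · have := h1 i
      have := h2 i
      omega
  have h' := Nat.ofDigits_inj_of_len_eq (by norm_num) (by simp) (key m hm) (key n hn) h
  obtain ⟨h1, h2⟩ := List.append_inj h' (by simp)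
  rw [List.ofFn_inj] at h1 h2
  ext (i | i)
  · have := congrFun h1 i
    have := congrFun h2 i
    omega
  · exact congrFun h1 i

/-- Distinct monomials go to distinct powers of `T`, so each coefficient of `Q` survives as a
coefficient of the image. -/
lemma eq_zero_of_aeval_kronecker {Q : MvPolynomial (Fin 9 ⊕ Fin 9) ℤ} (hQ : Q.totalDegree < 16)
    (h : aeval (fun v => (Polynomial.X : Polynomial ℤ) ^ kroneckerWeight v) Q = 0) : Q = 0 := by
  ext m
  by_contra hm
  have hm : m ∈ Q.support := mem_support_iff.2 hm
  have hd : ∀ n ∈ Q.support, n.degree < 16 := fun n hn => by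
    refine lt_of_le_of_lt ?_ hQ
    exact le_totalDegree hn
  have e : aeval (fun v => (Polynomial.X : Polynomial ℤ) ^ kroneckerWeight v) Q =
      ∑ n ∈ Q.support, Polynomial.monomial (Finsupp.linearCombination ℕ kroneckerWeight n)
        (Q.coeff n) := by
    rw [aeval_def, eval₂_eq]
    refine Finset.sum_congr rfl fun n _ => ?_
    rw [← Polynomial.C_mul_X_pow_eq_monomial, Finsupp.linearCombination_apply, Finsupp.sum,
      ← Finset.prod_pow_eq_pow_sum]
    simp [← pow_mul, mul_comm]
  rw [e] at h
  have := congrArg (fun p => p.coeff (Finsupp.linearCombination ℕ kroneckerWeight m)) h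
  simp only [Polynomial.finsetSum_coeff, Polynomial.coeff_monomial, Polynomial.coeff_zero] at this
  rw [Finset.sum_eq_single m] at this
  · simp_all
  · intro n hn hnm
    rw [if_neg fun e => hnm (kroneckerWeight_injOn (hd n hn) (hd m hm) e)]
  · exact fun h => absurd hm h

end SevenPoint
end

noncomputable section
namespace SevenPoint

open MvPolynomial SparsePoly

/-! ### The discriminant in the Plücker coordinates -/

section

variable {R S : Type*} [CommRing R] [CommRing S]

/-- The binary cubic `det (s x + t y)` undergoes a linear substitution, and the discriminant of a
binary cubic is an invariant of weight 6. -/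
lemma discr_pencilCubic_linearCombination (x y : Fin 9 → R) (α β γ δ : R) :
    (pencilCubic (fun i => α * x i + β * y i) fun i => γ * x i + δ * y i).discr =
      (α * δ - β * γ) ^ 6 * (pencilCubic x y).discr := by
  have ha : (pencilCubic (fun i => α * x i + β * y i) fun i => γ * x i + δ * y i).a =
      α ^ 3 * (pencilCubic x y).a + α ^ 2 * β * (pencilCubic x y).b +
        α * β ^ 2 * (pencilCubic x y).c + β ^ 3 * (pencilCubic x y).d := by
    simp only [pencilCubic, detSum]
    ring
  have hb : (pencilCubic (fun i => α * x i + β * y i) fun i => γ * x i + δ * y i).b =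
      3 * α ^ 2 * γ * (pencilCubic x y).a +
        (α ^ 2 * δ + 2 * α * β * γ) * (pencilCubic x y).b +
        (2 * α * β * δ + β ^ 2 * γ) * (pencilCubic x y).c +
        3 * β ^ 2 * δ * (pencilCubic x y).d := by
    simp only [pencilCubic, detSum]
    ring
  have hc : (pencilCubic (fun i => α * x i + β * y i) fun i => γ * x i + δ * y i).c =
      3 * α * γ ^ 2 * (pencilCubic x y).a +
        (2 * α * γ * δ + β * γ ^ 2) * (pencilCubic x y).b +
        (α * δ ^ 2 + 2 * β * γ * δ) * (pencilCubic x y).c +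
        3 * β * δ ^ 2 * (pencilCubic x y).d := by
    simp only [pencilCubic, detSum]
    ring
  have hd : (pencilCubic (fun i => α * x i + β * y i) fun i => γ * x i + δ * y i).d =
      γ ^ 3 * (pencilCubic x y).a + γ ^ 2 * δ * (pencilCubic x y).b +
        γ * δ ^ 2 * (pencilCubic x y).c + δ ^ 3 * (pencilCubic x y).d := by
    simp only [pencilCubic, detSum]
    ring
  simp only [Cubic.discr, ha, hb, hc, hd]
  ring

lemma bracket_linearCombination (x y : Fin 9 → R) (α β γ δ : R) (i j : Fin 9) :
    bracket (fun i => α * x i + β * y i) (fun i => γ * x i + δ * y i) i j =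
      (α * δ - β * γ) * bracket x y i j := by
  simp only [bracket]
  ring

lemma map_bracket (f : R →+* S) (x y : Fin 9 → R) (i j : Fin 9) :
    f (bracket x y i j) = bracket (f ∘ x) (f ∘ y) i j := by
  simp [bracket]

lemma map_discr_pencilCubic (f : R →+* S) (x y : Fin 9 → R) :
    f (pencilCubic x y).discr = (pencilCubic (f ∘ x) (f ∘ y)).discr := by
  simp [Cubic.discr, pencilCubic, detSum, map_ofNat]

lemma map_aeval_bracket [Algebra ℤ R] [Algebra ℤ S] (f : R →+* S) (x y : Fin 9 → R) :
    f (aeval (fun p : PluckerIndex => bracket x y p.1.1 p.1.2) discrPolynomial) =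
      aeval (fun p : PluckerIndex => bracket (f ∘ x) (f ∘ y) p.1.1 p.1.2) discrPolynomial := by
  simp only [discrPolynomial, aeval_ofTerms, map_list_sum, List.map_map, Function.comp_def,
    map_mul, map_intCast, map_list_prod, map_bracket]

end

/-- The values of the generic first matrix of a pencil under the normalization `x 8 = 0`. -/
def normalizedX (i : Fin 9) : MvPolynomial (Fin 9 ⊕ Fin 9) ℤ := if i = 8 then 0 else X (.inl i)

/-- The values of the generic second matrix of a pencil under the normalization `y 0 = 0`. -/
def normalizedY (i : Fin 9) : MvPolynomial (Fin 9 ⊕ Fin 9) ℤ := if i = 0 then 0 else X (.inr i)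

lemma isHomogeneous_normalizedX (i : Fin 9) : (normalizedX i).IsHomogeneous 1 := by
  unfold normalizedX
  split_ifs
  · exact isHomogeneous_zero _ _ _
  · exact isHomogeneous_X _ _

lemma isHomogeneous_normalizedY (i : Fin 9) : (normalizedY i).IsHomogeneous 1 := by
  unfold normalizedY
  split_ifs
  · exact isHomogeneous_zero _ _ _
  · exact isHomogeneous_X _ _

lemma aeval_kronecker_normalizedX (i : Fin 9) :
    aeval (fun v => (Polynomial.X : Polynomial ℤ) ^ kroneckerWeight v) (normalizedX i) =
      kroneckerX i := by
  fin_cases i <;> simp [normalizedX, kroneckerX, sparseX, kroneckerWeight, toPoly] <;>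
    exact (toPoly_power _).symm

lemma aeval_kronecker_normalizedY (i : Fin 9) :
    aeval (fun v => (Polynomial.X : Polynomial ℤ) ^ kroneckerWeight v) (normalizedY i) =
      kroneckerY i := by
  fin_cases i <;> simp [normalizedY, kroneckerY, sparseY, kroneckerWeight, toPoly] <;>
    exact (toPoly_power _).symm

lemma isHomogeneous_detSum {σ : Type*} {n : ℕ} {f : Fin 9 → Fin 9 → Fin 9 → MvPolynomial σ ℤ}
    (h : ∀ i j k, (f i j k).IsHomogeneous n) : (detSum f).IsHomogeneous n :=
  (((((h _ _ _).add (h _ _ _)).add (h _ _ _)).sub (h _ _ _)).sub (h _ _ _)).sub (h _ _ _)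

lemma isHomogeneous_discr {σ : Type*} {p : Cubic (MvPolynomial σ ℤ)} (ha : p.a.IsHomogeneous 3)
    (hb : p.b.IsHomogeneous 3) (hc : p.c.IsHomogeneous 3) (hd : p.d.IsHomogeneous 3) :
    p.discr.IsHomogeneous 12 := by
  have hn (n : ℤ) {q : MvPolynomial σ ℤ} (hq : q.IsHomogeneous 12) : (C n * q).IsHomogeneous 12 := by
    simpa using (isHomogeneous_C σ n).mul hq
  have e : p.discr = p.b ^ 2 * p.c ^ 2 + C (-4) * (p.a * p.c ^ 3) + C (-4) * (p.b ^ 3 * p.d) +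
      C (-27) * (p.a ^ 2 * p.d ^ 2) + C 18 * (p.a * p.b * p.c * p.d) := by
    simp only [Cubic.discr, map_neg, map_ofNat]
    ring
  rw [e]
  exact (((((hb.pow 2).mul (hc.pow 2)).add (hn _ (ha.mul (hc.pow 3)))).add
    (hn _ ((hb.pow 3).mul hd))).add (hn _ ((ha.pow 2).mul (hd.pow 2)))).add
    (hn _ (((ha.mul hb).mul hc).mul hd))

lemma isHomogeneous_discr_pencilCubic {σ : Type*} {x y : Fin 9 → MvPolynomial σ ℤ}
    (hx : ∀ i, (x i).IsHomogeneous 1) (hy : ∀ i, (y i).IsHomogeneous 1) :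
    (pencilCubic x y).discr.IsHomogeneous 12 := by
  refine isHomogeneous_discr ?_ ?_ ?_ ?_
  · exact isHomogeneous_detSum (f := fun i j k => x i * x j * x k) fun i j k =>
      ((hx i).mul (hx j)).mul (hx k)
  · exact isHomogeneous_detSum
      (f := fun i j k => x i * x j * y k + x i * y j * x k + y i * x j * x k) fun i j k =>
        ((((hx i).mul (hx j)).mul (hy k)).add (((hx i).mul (hy j)).mul (hx k))).add
          (((hy i).mul (hx j)).mul (hx k))
  · exact isHomogeneous_detSum
      (f := fun i j k => x i * y j * y k + y i * x j * y k + y i * y j * x k) fun i j k =>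
        ((((hx i).mul (hy j)).mul (hy k)).add (((hy i).mul (hx j)).mul (hy k))).add
          (((hy i).mul (hy j)).mul (hx k))
  · exact isHomogeneous_detSum (f := fun i j k => y i * y j * y k) fun i j k =>
      ((hy i).mul (hy j)).mul (hy k)

/-- Both sides are forms of degree 12 in the entries, which is below the bound 16 for the Kronecker
substitution, and they agree in `ℤ[T]` by the computation. -/
lemma aeval_normalized_discrPolynomial :
    aeval (fun p : PluckerIndex => bracket normalizedX normalizedY p.1.1 p.1.2) discrPolynomial =
      (pencilCubic normalizedX normalizedY).discr := by
  rw [← sub_eq_zero]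
  refine eq_zero_of_aeval_kronecker ?_ ?_
  · refine (IsHomogeneous.totalDegree_le (n := 12) ?_).trans_lt (by norm_num)
    refine IsHomogeneous.sub ?_
      (isHomogeneous_discr_pencilCubic isHomogeneous_normalizedX isHomogeneous_normalizedY)
    refine isHomogeneous_discrPolynomial.aeval (n := 2) _ fun p => ?_
    exact ((isHomogeneous_normalizedX _).mul (isHomogeneous_normalizedY _)).sub
      ((isHomogeneous_normalizedX _).mul (isHomogeneous_normalizedY _))
  · set φ := aeval (R := ℤ) fun v => (Polynomial.X : Polynomial ℤ) ^ kroneckerWeight v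
    have hX : φ.toRingHom ∘ normalizedX = kroneckerX := funext aeval_kronecker_normalizedX
    have hY : φ.toRingHom ∘ normalizedY = kroneckerY := funext aeval_kronecker_normalizedY
    have h1 := map_aeval_bracket φ.toRingHom normalizedX normalizedY
    have h2 := map_discr_pencilCubic φ.toRingHom normalizedX normalizedY
    rw [hX, hY] at h1 h2
    rw [map_sub, sub_eq_zero]
    exact h1.trans (aeval_kronecker_discrPolynomial.trans h2.symm)

section

variable {R : Type*} [CommRing R] [Algebra ℤ R]

lemma aeval_discrPolynomial_mul (r : R) (f : PluckerIndex → R) :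
    aeval (fun p => r * f p) discrPolynomial = r ^ 6 * aeval f discrPolynomial := by
  rw [discrPolynomial, aeval_ofTerms, aeval_ofTerms, ← List.sum_map_mul_left]
  refine congrArg List.sum (List.map_congr_left fun t ht => ?_)
  rw [List.prod_map_mul, List.map_const', List.prod_replicate, (isGoodTerm_of_mem ht).1]
  ring

lemma aeval_bracket_of_normalized {x y : Fin 9 → R} (hx : x 8 = 0) (hy : y 0 = 0) :
    aeval (fun p : PluckerIndex => bracket x y p.1.1 p.1.2) discrPolynomial =
      (pencilCubic x y).discr := by
  set φ := aeval (R := ℤ) (Sum.elim x y)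
  have hX : φ.toRingHom ∘ normalizedX = x := by
    funext i
    by_cases hi : i = 8 <;> simp [normalizedX, hi, hx, φ]
  have hY : φ.toRingHom ∘ normalizedY = y := by
    funext i
    by_cases hi : i = 0 <;> simp [normalizedY, hi, hy, φ]
  have h1 := map_aeval_bracket φ.toRingHom normalizedX normalizedY
  have h2 := map_discr_pencilCubic φ.toRingHom normalizedX normalizedY
  rw [hX, hY] at h1 h2
  rw [← h1, ← h2, aeval_normalized_discrPolynomial]

/-- At the `2 × 2` minors of `x` and `y`, the polynomial is the discriminant of the pencil. -/
theorem aeval_bracket_discrPolynomial (x y : Fin 9 → R) :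
    aeval (fun p : PluckerIndex => bracket x y p.1.1 p.1.2) discrPolynomial =
      (pencilCubic x y).discr := by
  let x' : Fin 9 → MvPolynomial (Fin 9 ⊕ Fin 9) ℤ := fun i => X (.inl i)
  let y' : Fin 9 → MvPolynomial (Fin 9 ⊕ Fin 9) ℤ := fun i => X (.inr i)
  -- The pair `y₈ x - x₈ y`, `-y₀ x + x₀ y` has the normalized shape, with entry 8 of the first and
  -- entry 0 of the second equal to zero. This is the determinant of the change of basis; its sixth
  -- power appears on both sides and is cancelled in the generic domain.
  have hne : y' 8 * x' 0 - -x' 8 * -y' 0 ≠ 0 := by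
    intro h
    have := congrArg (aeval (R := ℤ) (Sum.elim (fun i => if i = 0 then 1 else 0)
      fun i => if i = 8 then 1 else 0 : Fin 9 ⊕ Fin 9 → ℤ)) h
    simp [x', y'] at this
  have generic : aeval (fun p : PluckerIndex => bracket x' y' p.1.1 p.1.2) discrPolynomial =
      (pencilCubic x' y').discr := by
    refine mul_left_cancel₀ (pow_ne_zero 6 hne) ?_
    rw [← discr_pencilCubic_linearCombination, ← aeval_discrPolynomial_mul,
      ← aeval_bracket_of_normalized (by ring) (by ring)]
    simp only [bracket_linearCombination]
  set φ := aeval (R := ℤ) (Sum.elim x y)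
  have hX : φ.toRingHom ∘ x' = x := by
    funext i
    simp [x', φ]
  have hY : φ.toRingHom ∘ y' = y := by
    funext i
    simp [y', φ]
  have h1 := map_aeval_bracket φ.toRingHom x' y'
  have h2 := map_discr_pencilCubic φ.toRingHom x' y'
  rw [hX, hY] at h1 h2
  rw [← h1, ← h2, generic]

end

lemma vec_eq {R : Type} (F : Matrix (Fin 3) (Fin 3) R) :
    vec F = ![F 0 0, F 0 1, F 0 2, F 1 0, F 1 1, F 1 2, F 2 0, F 2 1, F 2 2] := by
  funext k
  fin_cases k <;> rfl

lemma pencilDiscr_eq (F₁ F₂ : Matrix (Fin 3) (Fin 3) ℝ) :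
    pencilDiscr F₁ F₂ = (pencilCubic (vec F₁) (vec F₂)).discr := by
  have h : pencilDet F₁ F₂ = (pencilCubic (vec F₁) (vec F₂)).toPoly := by
    simp only [pencilDet, Matrix.det_fin_three, Matrix.add_apply, Matrix.smul_apply,
      Matrix.map_apply, smul_eq_mul, Cubic.toPoly, pencilCubic, detSum, vec_eq,
      map_add, map_sub, map_mul]
    simp
    ring
  simp [pencilDiscr, h]

theorem aeval_pluckerOfSpan_discrPolynomial (F₁ F₂ : Matrix (Fin 3) (Fin 3) ℝ) :
    aeval (pluckerOfSpan F₁ F₂) discrPolynomial = pencilDiscr F₁ F₂ := by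
  rw [pencilDiscr_eq, ← aeval_bracket_discrPolynomial]
  rfl

end SevenPoint
end

noncomputable section
namespace SevenPoint

open MvPolynomial

lemma aeval_zero_discrPolynomial {R : Type} [CommRing R] [Algebra ℤ R] : aeval (0 : PluckerIndex → R) discrPolynomial = 0 := by
  simpa [Pi.zero_def] using aeval_discrPolynomial_mul (0 : R) 0

/-! ### The kernel of a `7 × 9` matrix and its maximal minors -/

section

variable {R : Type} [CommRing R]

/-- The determinant of the `9 × 9` matrix with the rows `u`, `v` and the rows of `L`. -/
def borderedDet (L : Matrix (Fin 7) (Fin 9) R) (u v : Fin 9 → R) : R :=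
  Matrix.det (Matrix.of (Matrix.vecCons u (Matrix.vecCons v L)) : Matrix (Fin 9) (Fin 9) R)

/-- The skew-symmetric matrix of the signed maximal minors of a `7 × 9` matrix. -/
def skewMinor (L : Matrix (Fin 7) (Fin 9) R) (i j : Fin 9) : R :=
  borderedDet L (Pi.single i 1) (Pi.single j 1)

/-- Deleting the smaller index first shifts the larger one down by one. This is the order in which
the Laplace expansion along the rows `e_i`, `e_j` deletes columns. -/
lemma skip_eq (p : PluckerIndex) (k : Fin 7) : skip p k =
    p.1.1.succAbove ((⟨p.1.2.1 - 1, by have := p.2; omega⟩ : Fin 8).succAbove k) := by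
  obtain ⟨⟨i, j⟩, h⟩ := p
  have : (i : ℕ) < j := h
  ext
  simp only [skip, Fin.succAbove, Fin.lt_def, Fin.val_castSucc]
  split_ifs <;> simp_all <;> omega

/-- The second expansion has sign `(-1) ^ (j - 1)` because column `i < j` is already gone, hence the
global minus. It is harmless for a form of even degree. -/
lemma pluckerOfKer_eq (L : Matrix (Fin 7) (Fin 9) R) (p : PluckerIndex) :
    pluckerOfKer L p = -skewMinor L p.1.1 p.1.2 := by
  obtain ⟨⟨i, j⟩, h⟩ := p
  have hij : (i : ℕ) < j := h
  let j' : Fin 8 := ⟨j.1 - 1, by omega⟩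
  have hj' (k : Fin 8) : i.succAbove k = j ↔ k = j' := by
    simp only [Fin.ext_iff, Fin.succAbove, Fin.lt_def, j']
    split_ifs <;> simp <;> simp at * <;> omega
  rw [skewMinor, borderedDet, Matrix.det_succ_row_zero, Finset.sum_eq_single i]
  · rw [Matrix.det_succ_row_zero, Finset.sum_eq_single j']
    · have e1 : skip ⟨(i, j), h⟩ = fun k => i.succAbove (j'.succAbove k) :=
        funext (skip_eq ⟨(i, j), h⟩)
      have e2 : (-1 : R) ^ (j : ℕ) = -(-1) ^ (j' : ℕ) := by
        have : (j : ℕ) = j' + 1 := by simp only [j']; omega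
        rw [this, pow_succ]
        ring
      have e3 : i.succAbove j' = j := (hj' j').2 rfl
      simp only [pluckerOfKer, e1, pow_add, e2]
      simp only [Matrix.submatrix_apply, Matrix.of_apply, Matrix.cons_val_zero, Pi.single_eq_same,
        Matrix.submatrix_submatrix, Matrix.cons_val_succ, e3]
      have e4 : (Matrix.vecCons (Pi.single j 1) L : Fin 8 → Fin 9 → R) 0 j = 1 :=
        Pi.single_eq_same j 1
      simp only [mul_one, mul_neg, neg_mul, mul_assoc, e4]
      rfl
    · intro k _ hk
      have : i.succAbove k ≠ j := fun e => hk ((hj' k).1 e)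
      simp [this]
    · simp
  · intro k _ hk
    simp [hk]
  · simp

lemma skewMinor_swap (L : Matrix (Fin 7) (Fin 9) R) (i j : Fin 9) :
    skewMinor L j i = -skewMinor L i j := by
  have h := Matrix.det_permute (Equiv.swap 0 1) (Matrix.of (Matrix.vecCons (Pi.single i 1)
    (Matrix.vecCons (Pi.single j 1) L)) : Matrix (Fin 9) (Fin 9) R)
  rw [Equiv.Perm.sign_swap (by decide), Units.val_neg, Units.val_one, Int.cast_neg, Int.cast_one,
    neg_one_mul] at h
  rw [skewMinor, skewMinor, borderedDet, borderedDet, ← h]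
  congr 1
  funext k
  refine Fin.cases ?_ (fun k => Fin.cases ?_ (fun k => ?_) k) k
  · exact congrArg (Matrix.vecCons (Pi.single i 1) (Matrix.vecCons (Pi.single j 1) L))
      (Equiv.swap_apply_left (0 : Fin 9) 1).symm
  · exact congrArg (Matrix.vecCons (Pi.single i 1) (Matrix.vecCons (Pi.single j 1) L))
      (Equiv.swap_apply_right (0 : Fin 9) 1).symm
  · exact congrArg (Matrix.vecCons (Pi.single i 1) (Matrix.vecCons (Pi.single j 1) L))
      (Equiv.swap_apply_of_ne_of_ne (Fin.succ_ne_zero _)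
        ((Fin.succ_injective _).ne (Fin.succ_ne_zero k))).symm

lemma borderedDet_eq_sum (L : Matrix (Fin 7) (Fin 9) R) (u v : Fin 9 → R) :
    borderedDet L u v = ∑ k, v k * borderedDet L u (Pi.single k 1) := by
  rw [borderedDet, Matrix.det_eq_sum_mul_adjugate_row _ 1]
  refine Finset.sum_congr rfl fun k _ => ?_
  rw [Matrix.adjugate_apply]
  congr 2
  funext a
  refine Fin.cases ?_ (fun a => Fin.cases ?_ (fun a => ?_) a) a <;> rfl

/-- The pairing of a row of `L` with this vector is a determinant in which that row occurs twice.
This supplies explicit kernel vectors. -/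
lemma mulVec_skewMinor (L : Matrix (Fin 7) (Fin 9) R) (i : Fin 9) :
    L.mulVec (skewMinor L i) = 0 := by
  funext r
  have h := borderedDet_eq_sum L (Pi.single i 1) (L r)
  have h0 : borderedDet L (Pi.single i 1) (L r) = 0 :=
    Matrix.det_zero_of_row_eq (i := Fin.succ 0) (j := r.succ.succ)
      ((Fin.succ_injective _).ne (Fin.succ_ne_zero r).symm) rfl
  rw [h0] at h
  exact h.symm

/-- Cramer's rule for the square matrix `N` with rows `e_i`, `e_j` and those of `L`: the vector `N
x` has only the two entries `x i` and `x j`, so `adj N * N x = det N • x` has two terms. -/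
lemma skewMinor_mul (L : Matrix (Fin 7) (Fin 9) R) {x : Fin 9 → R} (hx : L.mulVec x = 0)
    (i j k : Fin 9) : skewMinor L i j * x k = skewMinor L k j * x i + skewMinor L i k * x j := by
  let N : Matrix (Fin 9) (Fin 9) R :=
    Matrix.of (Matrix.vecCons (Pi.single i 1) (Matrix.vecCons (Pi.single j 1) L))
  have hN : N.mulVec x = Matrix.vecCons (x i) (Matrix.vecCons (x j) 0) := by
    funext a
    refine Fin.cases ?_ (fun a => Fin.cases ?_ (fun a => ?_) a) a
    · simp [N, Matrix.mulVec]
    · simp [N, Matrix.mulVec]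
    · exact congrFun hx a
  have h := congrFun (congrArg (fun M => Matrix.mulVec M x) (Matrix.adjugate_mul N)) k
  simp only [← Matrix.mulVec_mulVec, hN, Matrix.smul_mulVec, Matrix.one_mulVec, Pi.smul_apply,
    smul_eq_mul] at h
  have e0 : N.adjugate k 0 = skewMinor L k j := by
    rw [Matrix.adjugate_apply, skewMinor, borderedDet]
    congr 1
    funext a
    refine Fin.cases ?_ (fun a => Fin.cases ?_ (fun a => ?_) a) a <;> rfl
  have e1 : N.adjugate k 1 = skewMinor L i k := by
    rw [Matrix.adjugate_apply, skewMinor, borderedDet]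
    congr 1
    funext a
    refine Fin.cases ?_ (fun a => Fin.cases ?_ (fun a => ?_) a) a <;> rfl
  have e2 : skewMinor L i j = N.det := rfl
  rw [e2, ← h, ← e0, ← e1, Matrix.mulVec, dotProduct, Fin.sum_univ_succ, Fin.sum_univ_succ]
  simp

variable [IsDomain R]

/-- Two kernel vectors are determined by their entries `i` and `j` through Cramer's rule. Expanding
a minor in these entries leaves a quadratic expression in the `skewMinor`s, which the Plücker
relation collapses. -/
lemma skewMinor_mul_bracket {L : Matrix (Fin 7) (Fin 9) R} {x y : Fin 9 → R}
    (hx : L.mulVec x = 0) (hy : L.mulVec y = 0) {i j : Fin 9} (h : skewMinor L i j ≠ 0)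
    (k l : Fin 9) : skewMinor L i j * bracket x y k l = bracket x y i j * skewMinor L k l := by
  refine mul_left_cancel₀ h ?_
  have hxk := skewMinor_mul L hx i j k
  have hxl := skewMinor_mul L hx i j l
  have hyk := skewMinor_mul L hy i j k
  have hyl := skewMinor_mul L hy i j l
  -- The three-term Plücker relation is Cramer's rule applied to the kernel vector `skewMinor L k`.
  have hs := skewMinor_mul L (mulVec_skewMinor L k) i j l
  rw [skewMinor_swap L i k] at hs
  calc skewMinor L i j * (skewMinor L i j * bracket x y k l)
      = (skewMinor L i j * x k) * (skewMinor L i j * y l) -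
          (skewMinor L i j * x l) * (skewMinor L i j * y k) := by
        rw [bracket]; ring
    _ = bracket x y i j * (skewMinor L i j * skewMinor L k l) := by
        rw [hxk, hxl, hyk, hyl, hs, bracket]; ring
    _ = _ := by ring

variable [Algebra ℤ R]

lemma bracket_pow_mul_aeval_pluckerOfKer {L : Matrix (Fin 7) (Fin 9) R} {x y : Fin 9 → R}
    (hx : L.mulVec x = 0) (hy : L.mulVec y = 0) {i j : Fin 9} (h : skewMinor L i j ≠ 0) :
    bracket x y i j ^ 6 * aeval (pluckerOfKer L) discrPolynomial =
      skewMinor L i j ^ 6 * (pencilCubic x y).discr := by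
  rw [← aeval_bracket_discrPolynomial, ← aeval_discrPolynomial_mul, ← aeval_discrPolynomial_mul]
  simp only [skewMinor_mul_bracket hx hy h, pluckerOfKer_eq]
  have := aeval_discrPolynomial_mul (-1)
    fun p : PluckerIndex => bracket x y i j * skewMinor L p.1.1 p.1.2
  rw [Even.neg_one_pow (by decide), one_mul] at this
  rw [← this]
  congr 2
  funext p
  ring

/-- The polynomial vanishes at the maximal minors of `L` if all pencils spanned by a fixed nonzero
matrix and a matrix in the kernel of `L` have discriminant zero. -/
lemma aeval_pluckerOfKer_eq_zero {L : Matrix (Fin 7) (Fin 9) R} {x : Fin 9 → R}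
    (hx : L.mulVec x = 0) (hx0 : x ≠ 0)
    (h : ∀ y, L.mulVec y = 0 → (pencilCubic x y).discr = 0) :
    aeval (pluckerOfKer L) discrPolynomial = 0 := by
  by_cases hL : ∃ i j, skewMinor L i j ≠ 0
  · obtain ⟨i, j, hij⟩ := hL
    have key (a : Fin 9) (ha : bracket x (skewMinor L a) i j ≠ 0) :
        aeval (pluckerOfKer L) discrPolynomial = 0 := by
      have e := bracket_pow_mul_aeval_pluckerOfKer hx (mulVec_skewMinor L a) hij
      rw [h _ (mulVec_skewMinor L a), mul_zero] at e
      exact (mul_eq_zero.1 e).resolve_left (pow_ne_zero 6 ha)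
    have hii : ∀ a, skewMinor L a a = 0 := fun a =>
      Matrix.det_zero_of_row_eq (i := 0) (j := 1) (by decide) rfl
    -- The minor at `i`, `j` of `x` and row `i` of the skew matrix is `x i` times `skewMinor L i j`;
    -- with row `j` it is `x j` times the same factor. If both entries were zero, Cramer's rule
    -- would give `x = 0`.
    by_cases hi : x i = 0
    · have hj : x j ≠ 0 := by
        intro hj
        apply hx0
        funext k
        have := skewMinor_mul L hx i j k
        simpa [hi, hj, hij] using this
      refine key j ?_
      rw [bracket, hi, skewMinor_swap L i j]
      simp [hj, hij]
    · refine key i ?_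
      rw [bracket, hii]
      simp [hi, hij]
  · push Not at hL
    have : pluckerOfKer L = 0 := funext fun p => by simp [pluckerOfKer_eq, hL]
    rw [this, aeval_zero_discrPolynomial]

/-- The polynomial vanishes at the maximal minors of `L` if the kernel of `L` contains two
linearly independent matrices whose pencil has discriminant zero. -/
lemma aeval_pluckerOfKer_eq_zero_of_discr {L : Matrix (Fin 7) (Fin 9) R} {x y : Fin 9 → R}
    (hx : L.mulVec x = 0) (hy : L.mulVec y = 0) (h : (pencilCubic x y).discr = 0)
    {k l : Fin 9} (hkl : bracket x y k l ≠ 0) :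
    aeval (pluckerOfKer L) discrPolynomial = 0 := by
  by_cases hL : ∃ i j, skewMinor L i j ≠ 0
  · obtain ⟨i, j, hij⟩ := hL
    have e := bracket_pow_mul_aeval_pluckerOfKer hx hy hij
    rw [h, mul_zero] at e
    refine (mul_eq_zero.1 e).resolve_left (pow_ne_zero 6 fun h0 => ?_)
    have := skewMinor_mul_bracket hx hy hij k l
    rw [h0, zero_mul] at this
    exact mul_ne_zero hij hkl this
  · push Not at hL
    have : pluckerOfKer L = 0 := funext fun p => by simp [pluckerOfKer_eq, hL]
    rw [this, aeval_zero_discrPolynomial]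

end

end SevenPoint
end

noncomputable section
namespace SevenPoint

open MvPolynomial

/-! ### The degree in an image point -/

/-- The substitution that multiplies the coordinates of one image point by `T`. -/
def scalePoint (i : Fin 7) (s : Fin 2) : MvPolynomial (Fin 7 × Fin 2 × Fin 2) ℤ →ₐ[ℤ]
    Polynomial (MvPolynomial (Fin 7 × Fin 2 × Fin 2) ℤ) :=
  aeval fun v => if v.1 = i ∧ v.2.1 = s then Polynomial.X * Polynomial.C (X v)
    else Polynomial.C (X v)

lemma scalePoint_monomial (i : Fin 7) (s : Fin 2) (m : Fin 7 × Fin 2 × Fin 2 →₀ ℕ) (c : ℤ) :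
    scalePoint i s (monomial m c) =
      Polynomial.monomial (m (i, s, 0) + m (i, s, 1)) (monomial m c) := by
  have hv (v : Fin 7 × Fin 2 × Fin 2) : scalePoint i s (X v) =
      Polynomial.X ^ (if v.1 = i ∧ v.2.1 = s then 1 else 0) * Polynomial.C (X v) := by
    rw [scalePoint, aeval_X]
    split_ifs <;> simp
  have hs : ∑ v : Fin 7 × Fin 2 × Fin 2, (if v.1 = i ∧ v.2.1 = s then 1 else 0) * m v =
      m (i, s, 0) + m (i, s, 1) := by
    simp only [ite_mul, one_mul, zero_mul, Fintype.sum_prod_type, Fin.sum_univ_two (M := ℕ)]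
    rw [Finset.sum_eq_single i (fun j _ hj => by simp [hj]) (by simp)]
    fin_cases s <;> simp
  rw [monomial_eq, map_mul, Finsupp.prod_fintype _ _ (by simp), map_prod]
  simp only [map_pow, hv, mul_pow, ← pow_mul]
  rw [Finset.prod_mul_distrib, Finset.prod_pow_eq_pow_sum, hs, ← Polynomial.C_mul_X_pow_eq_monomial,
    map_mul, map_prod]
  simp only [map_pow]
  have : scalePoint i s (C c) = Polynomial.C (C c) := by
    rw [← algebraMap_eq, AlgHom.commutes]
    simp
  rw [this]
  ring

lemma coeff_coeff_scalePoint (i : Fin 7) (s : Fin 2)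
    (D : MvPolynomial (Fin 7 × Fin 2 × Fin 2) ℤ) (m : Fin 7 × Fin 2 × Fin 2 →₀ ℕ) (n : ℕ) :
    ((scalePoint i s D).coeff n).coeff m =
      if m (i, s, 0) + m (i, s, 1) = n then D.coeff m else 0 := by
  induction D using MvPolynomial.induction_on' with
  | monomial u a =>
    rw [scalePoint_monomial, Polynomial.coeff_monomial]
    split_ifs with h1 h2 h2 <;> simp only [coeff_monomial, coeff_zero]
    · rw [if_neg]
      rintro rfl
      exact h2 h1
    · rw [if_neg]
      rintro rfl
      exact h1 h2
  | add p q hp hq =>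
    rw [map_add, Polynomial.coeff_add, coeff_add, hp, hq, coeff_add]
    split_ifs <;> simp

/-- The power of `T` produced by `scalePoint` records the degree in the chosen point, and distinct
monomials stay distinct. -/
lemma degreeInPoint_eq {D : MvPolynomial (Fin 7 × Fin 2 × Fin 2) ℤ} {i : Fin 7} {s : Fin 2} {n : ℕ}
    (h1 : (scalePoint i s D).natDegree ≤ n) (h2 : (scalePoint i s D).coeff n ≠ 0) :
    degreeInPoint D i s = n := by
  apply le_antisymm
  · refine Finset.sup_le fun m hm => ?_
    by_contra! h
    have := coeff_coeff_scalePoint i s D m (m (i, s, 0) + m (i, s, 1))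
    rw [if_pos rfl, Polynomial.coeff_eq_zero_of_natDegree_lt (h1.trans_lt h), coeff_zero] at this
    exact mem_support_iff.1 hm this.symm
  · obtain ⟨m, hm⟩ := ne_zero_iff.1 h2
    rw [coeff_coeff_scalePoint] at hm
    split_ifs at hm with h
    · rw [← h]
      exact Finset.le_sup (f := fun m => m (i, s, 0) + m (i, s, 1)) (mem_support_iff.2 hm)
    · exact absurd rfl hm

section

variable {R : Type*} [CommRing R] {f : PluckerIndex → Polynomial R}

lemma natDegree_aeval_discrPolynomial_le (hf : ∀ p, (f p).natDegree ≤ 1) :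
    (aeval f discrPolynomial).natDegree ≤ 6 := by
  rw [discrPolynomial, aeval_ofTerms]
  refine (Polynomial.natDegree_list_sum_le _).trans ?_
  rw [List.map_map]
  refine List.max_le_of_forall_le _ _ fun n hn => ?_
  obtain ⟨t, ht, rfl⟩ := List.mem_map.1 hn
  rw [Function.comp_apply, ← Polynomial.C_eq_intCast]
  refine (Polynomial.natDegree_C_mul_le _ _).trans ((Polynomial.natDegree_list_prod_le _).trans ?_)
  rw [List.map_map]
  refine (List.sum_le_card_nsmul _ 1 fun n hn => ?_).trans ?_
  · obtain ⟨e, _, rfl⟩ := List.mem_map.1 hn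
    exact hf _
  · simp [(isGoodTerm_of_mem ht).1]

lemma coeff_aeval_discrPolynomial [Algebra ℤ R] (hf : ∀ p, (f p).natDegree ≤ 1) :
    (aeval f discrPolynomial).coeff 6 = aeval (fun p => (f p).coeff 1) discrPolynomial := by
  rw [discrPolynomial, aeval_ofTerms, aeval_ofTerms, Polynomial.coeff_list_sum_map]
  refine congrArg List.sum (List.map_congr_left fun t ht => ?_)
  rw [← Polynomial.C_eq_intCast, Polynomial.coeff_C_mul]
  have := Polynomial.coeff_list_prod_of_natDegree_le (t.1.map fun e => f (toIndex e)) 1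
    (fun q hq => by obtain ⟨e, _, rfl⟩ := List.mem_map.1 hq; exact hf _)
  rw [List.length_map, (isGoodTerm_of_mem ht).1, List.map_map] at this
  exact congrArg _ this

end

section

variable {R S : Type} [CommRing R] [CommRing S]

lemma map_pluckerOfKer {F : Type*} [FunLike F R S] [RingHomClass F R S] (f : F)
    (L : Matrix (Fin 7) (Fin 9) R) (p : PluckerIndex) :
    f (pluckerOfKer L p) = pluckerOfKer (L.map f) p := by
  simp only [pluckerOfKer, map_mul, map_pow, map_neg, map_one, Matrix.submatrix_map]
  exact congrArg _ ((RingHom.map_det (f : R →+* S) _))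

/-- The additive and homogeneous functions on `R ^ 9`. -/
def IsRowLinear (K : (Fin 9 → R) → R) : Prop :=
  ∀ (t : R) (u a b : Fin 9 → R), (∀ k, u k = t * a k + b k) → K u = t * K a + K b

lemma isRowLinear_pluckerOfKer (L : Matrix (Fin 7) (Fin 9) R) (i : Fin 7) (p : PluckerIndex) :
    IsRowLinear fun u => pluckerOfKer (L.updateRow i u) p := by
  intro t u a b hu
  have h (u : Fin 9 → R) : (L.updateRow i u).submatrix id (skip p) =
      (L.submatrix id (skip p)).updateRow i (u ∘ skip p) := by
    ext r k
    simp only [Matrix.submatrix_apply, Matrix.updateRow_apply, id, Function.comp]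
  have e : u ∘ skip p = t • (a ∘ skip p) + b ∘ skip p := funext fun k => hu _
  simp only [pluckerOfKer, h, e, Matrix.det_updateRow_add, Matrix.det_updateRow_smul]
  ring

lemma IsRowLinear.apply_X_mul_add {K : (Fin 9 → Polynomial R) → Polynomial R} (hK : IsRowLinear K)
    (a b : Fin 9 → R) {v w : R} (ha : K (fun k => Polynomial.C (a k)) = Polynomial.C v)
    (hb : K (fun k => Polynomial.C (b k)) = Polynomial.C w) :
    K (fun k => Polynomial.X * Polynomial.C (a k) + Polynomial.C (b k)) =
      Polynomial.X * Polynomial.C v + Polynomial.C w := by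
  rw [← ha, ← hb]
  exact hK _ _ _ _ fun _ => rfl

lemma pluckerOfKer_updateRow_map_C (L : Matrix (Fin 7) (Fin 9) R) (i : Fin 7) (a : Fin 9 → R)
    (p : PluckerIndex) : pluckerOfKer ((L.map Polynomial.C).updateRow i
      fun k => Polynomial.C (a k)) p = Polynomial.C (pluckerOfKer (L.updateRow i a) p) := by
  rw [map_pluckerOfKer, Matrix.map_updateRow]
  simp only [Function.comp_def]

/-- The part of the row `vec (vecMulVec (homogenize δ) (homogenize γ))` that is linear in `γ`
(for `s = 0`) or in `δ` (for `s = 1`). -/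
def linearRow (s : Fin 2) (γ δ : Fin 2 → R) : Fin 9 → R :=
  if s = 0 then vec (Matrix.vecMulVec (homogenize δ) ![γ 0, γ 1, 0])
  else vec (Matrix.vecMulVec ![δ 0, δ 1, 0] (homogenize γ))

/-- The part of the row `vec (vecMulVec (homogenize δ) (homogenize γ))` that is constant in `γ`
(for `s = 0`) or in `δ` (for `s = 1`). -/
def constantRow (s : Fin 2) (γ δ : Fin 2 → R) : Fin 9 → R :=
  if s = 0 then vec (Matrix.vecMulVec (homogenize δ) ![0, 0, 1])
  else vec (Matrix.vecMulVec ![0, 0, 1] (homogenize γ))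

lemma map_linearRow {F : Type*} [FunLike F R S] [RingHomClass F R S] (f : F) (s : Fin 2)
    (γ δ : Fin 2 → R) : f ∘ linearRow s γ δ = linearRow s (f ∘ γ) (f ∘ δ) := by
  funext k
  unfold linearRow
  split_ifs <;> fin_cases k <;> simp [vec, Matrix.vecMulVec_apply, homogenize]

lemma map_epipolarMatrix {F : Type*} [FunLike F R S] [RingHomClass F R S] (f : F)
    (x : ImageData R) :
    (epipolarMatrix x).map f = epipolarMatrix fun i => (f ∘ (x i).1, f ∘ (x i).2) := by
  ext r k
  fin_cases k <;> simp [epipolarMatrix, vec, homogenize]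

end

lemma map_scalePoint_epipolarMatrix (i : Fin 7) (s : Fin 2) :
    (epipolarMatrix genericImageData).map (scalePoint i s) =
      ((epipolarMatrix genericImageData).map Polynomial.C).updateRow i fun k =>
        Polynomial.X * Polynomial.C
          (linearRow s (genericImageData i).1 (genericImageData i).2 k) +
        Polynomial.C (constantRow s (genericImageData i).1 (genericImageData i).2 k) := by
  have h0 (c : Fin 2) : scalePoint i s (X (i, s, c)) = Polynomial.X * Polynomial.C (X (i, s, c)) := by
    simp [scalePoint]
  have h1 {r : Fin 7} {t : Fin 2} (c : Fin 2) (h : ¬ (r = i ∧ t = s)) :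
      scalePoint i s (X (r, t, c)) = Polynomial.C (X (r, t, c)) := by
    simp [scalePoint, h]
  ext1 r k
  rw [Matrix.updateRow_apply]
  split_ifs with hr
  · subst hr
    by_cases hs : s = 0
    · subst hs
      have h2 (c : Fin 2) := h1 (r := r) (t := 1) c (by simp)
      fin_cases k <;> simp [epipolarMatrix, vec, Matrix.vecMulVec_apply, homogenize, linearRow,
        constantRow, genericImageData, h0, h2] <;> ring
    · obtain rfl : s = 1 := by omega
      have h2 (c : Fin 2) := h1 (r := r) (t := 0) c (by simp)
      fin_cases k <;> simp [epipolarMatrix, vec, Matrix.vecMulVec_apply, homogenize, linearRow,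
        constantRow, genericImageData, h0, h2] <;> ring
  · have h2 (t c : Fin 2) := h1 (r := r) (t := t) c (by simp [hr])
    fin_cases k <;> simp [epipolarMatrix, vec, homogenize, genericImageData, h2]

lemma scalePoint_pluckerOfKer (i : Fin 7) (s : Fin 2) (p : PluckerIndex) :
    scalePoint i s (pluckerOfKer (epipolarMatrix genericImageData) p) =
      Polynomial.X * Polynomial.C (pluckerOfKer ((epipolarMatrix genericImageData).updateRow i
        (linearRow s (genericImageData i).1 (genericImageData i).2)) p) +
      Polynomial.C (pluckerOfKer ((epipolarMatrix genericImageData).updateRow i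
        (constantRow s (genericImageData i).1 (genericImageData i).2)) p) := by
  rw [map_pluckerOfKer, map_scalePoint_epipolarMatrix]
  exact (isRowLinear_pluckerOfKer _ i p).apply_X_mul_add _ _ (pluckerOfKer_updateRow_map_C ..)
    (pluckerOfKer_updateRow_map_C ..)

/-- The Plücker coordinates become affine in `T`, so the coefficient of `T ^ 6` is the form at their
linear coefficients, which are the maximal minors with row `i` replaced by its linear part. -/
lemma degreeInPoint_inImageData {i : Fin 7} {s : Fin 2}
    (h : aeval (pluckerOfKer ((epipolarMatrix genericImageData).updateRow i
        (linearRow s (genericImageData i).1 (genericImageData i).2))) discrPolynomial ≠ 0) :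
    degreeInPoint (inImageData discrPolynomial) i s = 6 := by
  have e : scalePoint i s (inImageData discrPolynomial) = aeval (fun p => scalePoint i s
      (pluckerOfKer (epipolarMatrix genericImageData) p)) discrPolynomial := by
    rw [inImageData, ← AlgHom.comp_apply, comp_aeval]
  have hf (p : PluckerIndex) : (scalePoint i s
      (pluckerOfKer (epipolarMatrix genericImageData) p)).natDegree ≤ 1 := by
    rw [scalePoint_pluckerOfKer]
    compute_degree
  apply degreeInPoint_eq
  · rw [e]
    exact natDegree_aeval_discrPolynomial_le hf
  · rw [e, coeff_aeval_discrPolynomial hf]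
    have h1 : (fun p => (scalePoint i s
        (pluckerOfKer (epipolarMatrix genericImageData) p)).coeff 1) =
        pluckerOfKer ((epipolarMatrix genericImageData).updateRow i
          (linearRow s (genericImageData i).1 (genericImageData i).2)) := funext fun p => by
      rw [scalePoint_pluckerOfKer]
      simp
    rw [h1]
    exact h

end SevenPoint
end

/-! ### A configuration at which the part of degree 6 is nonzero -/

noncomputable section
namespace SevenPoint

open MvPolynomial

/-- A nonvanishing criterion without determinants: one maximal minor is nonzero by injectivity, and
then the form is nonzero because the discriminant of a pencil in the kernel is. The permutation
allows the special row to sit in any position. -/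
lemma aeval_pluckerOfKer_ne_zero {M : Matrix (Fin 7) (Fin 9) ℝ} {x y : Fin 9 → ℝ}
    (hx : M.mulVec x = 0) (hy : M.mulVec y = 0) (hxy : (pencilCubic x y).discr ≠ 0)
    (p : PluckerIndex) (hM : ∀ v, (M.submatrix id (skip p)).mulVec v = 0 → v = 0)
    (σ : Equiv.Perm (Fin 7)) :
    aeval (pluckerOfKer (M.submatrix σ id)) discrPolynomial ≠ 0 := by
  have hσ {z : Fin 9 → ℝ} (hz : M.mulVec z = 0) : (M.submatrix σ id).mulVec z = 0 :=
    funext fun k => congrFun hz (σ k)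
  have hp : pluckerOfKer (M.submatrix σ id) p ≠ 0 := by
    refine mul_ne_zero (pow_ne_zero _ (by norm_num)) fun h0 => ?_
    obtain ⟨v, hv, h⟩ := Matrix.exists_mulVec_eq_zero_iff.2 h0
    refine hv (hM v (funext fun k => ?_))
    have := congrFun h (σ.symm k)
    simpa [Matrix.mulVec, dotProduct] using this
  have hs : skewMinor (M.submatrix σ id) p.1.1 p.1.2 ≠ 0 := fun h => hp (by
    rw [pluckerOfKer_eq, h, neg_zero])
  intro h
  have := bracket_pow_mul_aeval_pluckerOfKer (hσ hx) (hσ hy) hs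
  rw [h, mul_zero] at this
  exact mul_ne_zero (pow_ne_zero 6 hs) hxy this.symm

/-- Image data of points on a line through a base point and of six generic points, related by the
Cremona transformation `(p, q) ↦ (p⁻¹, q⁻¹)`. Their epipolar constraints are satisfied by all
diagonal matrices of trace zero. -/
def cremonaData : Fin 2 → ImageData ℝ :=
  ![![(![1, 0], ![0, 0]), (![1, 1], ![1, 1]), (![1, -1], ![1, -1]), (![-1, 1], ![-1, 1]),
    (![-1, -1], ![-1, -1]), (![2, 1], ![1 / 2, 1]), (![1, 2], ![1, 1 / 2])],
  ![(![0, 0], ![1, 0]), (![1, 1], ![1, 1]), (![1, -1], ![1, -1]), (![-1, 1], ![-1, 1]),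
    (![-1, -1], ![-1, -1]), (![1 / 2, 1], ![2, 1]), (![1, 1 / 2], ![1, 2])]]

/-- The epipolar constraints of `cremonaData`, where the first one is replaced by its part that is
linear in the first point. -/
def cremonaMatrix (s : Fin 2) : Matrix (Fin 7) (Fin 9) ℝ :=
  (epipolarMatrix (cremonaData s)).updateRow 0
    (linearRow s (cremonaData s 0).1 (cremonaData s 0).2)

lemma cremonaMatrix_zero : cremonaMatrix 0 = !![0, 0, 0, 0, 0, 0, 1, 0, 0;
    1, 1, 1, 1, 1, 1, 1, 1, 1; 1, -1, 1, -1, 1, -1, 1, -1, 1; 1, -1, -1, -1, 1, 1, -1, 1, 1;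
    1, 1, -1, 1, 1, -1, -1, -1, 1; 1, 1 / 2, 1 / 2, 2, 1, 1, 2, 1, 1;
    1, 2, 1, 1 / 2, 1, 1 / 2, 1, 2, 1] := by
  ext r k
  fin_cases r <;> fin_cases k <;>
    simp [cremonaMatrix, cremonaData, linearRow, epipolarMatrix, vec, homogenize,
      Matrix.updateRow_apply]

lemma cremonaMatrix_one : cremonaMatrix 1 = !![0, 0, 1, 0, 0, 0, 0, 0, 0;
    1, 1, 1, 1, 1, 1, 1, 1, 1; 1, -1, 1, -1, 1, -1, 1, -1, 1; 1, -1, -1, -1, 1, 1, -1, 1, 1;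
    1, 1, -1, 1, 1, -1, -1, -1, 1; 1, 2, 2, 1 / 2, 1, 1, 1 / 2, 1, 1;
    1, 1 / 2, 1, 2, 1, 2, 1, 1 / 2, 1] := by
  ext r k
  fin_cases r <;> fin_cases k <;>
    simp [cremonaMatrix, cremonaData, linearRow, epipolarMatrix, vec, homogenize,
      Matrix.updateRow_apply]

lemma aeval_cremonaMatrix_ne_zero (s : Fin 2) (σ : Equiv.Perm (Fin 7)) :
    aeval (pluckerOfKer ((cremonaMatrix s).submatrix σ id)) discrPolynomial ≠ 0 := by
  have hskip : skip ⟨(0, 4), by decide⟩ = ![1, 2, 3, 5, 6, 7, 8] := by decide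
  -- The kernel consists of the diagonal matrices of trace zero, spanned by `diag(1, 0, -1)` and
  -- `diag(0, 1, -1)`. Their cubic `-t² - t` has discriminant 1. Columns 0 and 4 are the free
  -- entries `F₁₁` and `F₂₂`.
  refine aeval_pluckerOfKer_ne_zero (x := ![1, 0, 0, 0, 0, 0, 0, 0, -1])
    (y := ![0, 0, 0, 0, 1, 0, 0, 0, -1]) ?_ ?_ ?_ ⟨(0, 4), by decide⟩ ?_ σ
  · funext r
    fin_cases s <;> fin_cases r <;>
      simp [cremonaMatrix_zero, cremonaMatrix_one, Matrix.mulVec, dotProduct, Fin.sum_univ_succ]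
  · funext r
    fin_cases s <;> fin_cases r <;>
      simp [cremonaMatrix_zero, cremonaMatrix_one, Matrix.mulVec, dotProduct, Fin.sum_univ_succ]
  · simp [pencilCubic, detSum, Cubic.discr]
  · intro v hv
    rw [hskip] at hv
    have h (r : Fin 7) := congrFun hv r
    fin_cases s
    · have h0 := h 0
      have h1 := h 1
      have h2 := h 2
      have h3 := h 3
      have h4 := h 4
      have h5 := h 5
      have h6 := h 6
      simp [cremonaMatrix_zero, Matrix.mulVec, dotProduct, Fin.sum_univ_succ] at h0 h1 h2 h3 h4 h5 h6
      funext k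
      fin_cases k <;> simp <;> linarith
    · have h0 := h 0
      have h1 := h 1
      have h2 := h 2
      have h3 := h 3
      have h4 := h 4
      have h5 := h 5
      have h6 := h 6
      simp [cremonaMatrix_one, Matrix.mulVec, dotProduct, Fin.sum_univ_succ] at h0 h1 h2 h3 h4 h5 h6
      funext k
      fin_cases k <;> simp <;> linarith

theorem degreeInPoint_inImageData_discrPolynomial (i : Fin 7) (s : Fin 2) :
    degreeInPoint (inImageData discrPolynomial) i s = 6 := by
  apply degreeInPoint_inImageData
  intro h
  let x : ImageData ℝ := fun k => cremonaData s (Equiv.swap 0 i k)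
  let φ : MvPolynomial (Fin 7 × Fin 2 × Fin 2) ℤ →ₐ[ℤ] ℝ := aeval (entries x)
  have hx1 (k : Fin 7) : φ ∘ (genericImageData k).1 = (x k).1 := by
    funext c
    simp [φ, genericImageData, entries]
  have hx2 (k : Fin 7) : φ ∘ (genericImageData k).2 = (x k).2 := by
    funext c
    simp [φ, genericImageData, entries]
  have hL : ((epipolarMatrix genericImageData).updateRow i
      (linearRow s (genericImageData i).1 (genericImageData i).2)).map φ =
      (cremonaMatrix s).submatrix (Equiv.swap 0 i) id := by
    have e1 : (epipolarMatrix genericImageData).map φ = epipolarMatrix x := by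
      refine (map_epipolarMatrix φ genericImageData).trans ?_
      exact congrArg epipolarMatrix (funext fun k => Prod.ext (hx1 k) (hx2 k))
    have e2 : φ ∘ linearRow s (genericImageData i).1 (genericImageData i).2 =
        linearRow s (x i).1 (x i).2 := by
      refine (map_linearRow φ s _ _).trans ?_
      exact congrArg₂ (linearRow s) (hx1 i) (hx2 i)
    rw [Matrix.map_updateRow, e1, e2]
    ext k c
    by_cases hk : k = i
    · subst hk
      simp [cremonaMatrix, x]
    · have : Equiv.swap 0 i k ≠ 0 := fun e => hk (by
        rwa [Equiv.swap_apply_eq_iff, Equiv.swap_apply_left] at e)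
      simp [cremonaMatrix, hk, this, x, epipolarMatrix]
  refine aeval_cremonaMatrix_ne_zero s (Equiv.swap 0 i) ?_
  rw [← hL]
  have := congrArg φ h
  rw [map_zero, ← AlgHom.comp_apply, comp_aeval] at this
  simpa only [map_pluckerOfKer] using this

end SevenPoint
end

noncomputable section
namespace SevenPoint
open MvPolynomial Matrix

/-! ### Normal form of world scenes -/

/-- The camera `[I | 0]`. -/
def stdCamera : Fin 3 → Fin 4 → ℝ := fun i j => if j = i.castSucc then 1 else 0

lemma stdCamera_mulVec (w : Fin 4 → ℝ) (i : Fin 3) :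
    (of stdCamera).mulVec w i = w i.castSucc := by
  simp [mulVec, dotProduct, stdCamera]

/-- The left `3 × 3` block of a camera. -/
def leftBlock (Q : Fin 3 → Fin 4 → ℝ) : Matrix (Fin 3) (Fin 3) ℝ := of fun i j => Q i j.castSucc

/-- The last column of a camera. -/
def lastColumn (Q : Fin 3 → Fin 4 → ℝ) : Fin 3 → ℝ := fun i => Q i 3

/-- The first three coordinates of a vector. -/
def firstThree (w : Fin 4 → ℝ) : Fin 3 → ℝ := fun i => w i.castSucc

lemma camera_mulVec (Q : Fin 3 → Fin 4 → ℝ) (w : Fin 4 → ℝ) :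
    (of Q).mulVec w = (leftBlock Q).mulVec (firstThree w) + w 3 • lastColumn Q := by
  funext i
  simp only [mulVec, dotProduct, Fin.sum_univ_castSucc (n := 3), leftBlock, of_apply, lastColumn,
    Pi.add_apply, Pi.smul_apply, smul_eq_mul, firstThree]
  rw [mul_comm (w 3)]
  rfl

lemma exists_ker_eq_span {M : Matrix (Fin 3) (Fin 4) ℝ} (hM : M.rank = 3) :
    ∃ k ≠ 0, M.mulVec k = 0 ∧ ∀ w, M.mulVec w = 0 → ∃ t : ℝ, w = t • k := by
  have h := LinearMap.finrank_range_add_finrank_ker M.mulVecLin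
  have hr : Module.finrank ℝ (LinearMap.range M.mulVecLin) = 3 := hM
  rw [hr, Module.finrank_fin_fun] at h
  have h1 : Module.finrank ℝ (LinearMap.ker M.mulVecLin) = 1 := by omega
  obtain ⟨⟨k, hk⟩, hk0, hspan⟩ := finrank_eq_one_iff'.1 h1
  refine ⟨k, fun h => hk0 (Subtype.ext h), hk, fun w hw => ?_⟩
  obtain ⟨t, ht⟩ := hspan ⟨w, hw⟩
  exact ⟨t, (congrArg Subtype.val ht).symm⟩

lemma exists_dotProduct_ne_zero {k l : Fin 4 → ℝ} (hk : k ≠ 0) (hl : l ≠ 0) :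
    ∃ r : Fin 4 → ℝ, r ⬝ᵥ k ≠ 0 ∧ r ⬝ᵥ l ≠ 0 := by
  have hkk : k ⬝ᵥ k ≠ 0 := fun h => hk (dotProduct_self_eq_zero.1 h)
  have hll : l ⬝ᵥ l ≠ 0 := fun h => hl (dotProduct_self_eq_zero.1 h)
  by_cases h : k ⬝ᵥ l = 0
  · refine ⟨k + l, ?_, ?_⟩
    · rwa [add_dotProduct, dotProduct_comm l k, h, add_zero]
    · rwa [add_dotProduct, h, zero_add]
  · exact ⟨k, hkk, h⟩

/-- The new coordinates are the rows of `P` and a plane `r` that avoids both camera centers.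
Avoiding the first center makes the coordinate change invertible; avoiding the second makes the left
block of the second camera invertible. The last column is, up to scale, the image of the first
center in the second camera, nonzero because the centers differ. -/
lemma exists_normalForm (v : {v : Ambient // IsScene v}) :
    ∃ u : {v : Ambient // IsScene v}, v ≈ u ∧ u.1.1 = stdCamera ∧
      (leftBlock u.1.2.1).det ≠ 0 ∧ lastColumn u.1.2.1 ≠ 0 := by
  obtain ⟨⟨P, Q, Γ⟩, hP, hQ, hc, h1, h2⟩ := v
  obtain ⟨k, hk0, hk, hks⟩ := exists_ker_eq_span hP
  obtain ⟨l, hl0, hl, hls⟩ := exists_ker_eq_span hQ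
  obtain ⟨r, hrk, hrl⟩ := exists_dotProduct_ne_zero hk0 hl0
  dsimp only at *
  have hQk : (of Q).mulVec k ≠ 0 := by
    intro hQk
    obtain ⟨t, rfl⟩ := hls k hQk
    have ht : t ≠ 0 := by
      rintro rfl
      simp at hk0
    apply hc
    ext w
    simp only [LinearMap.mem_ker, mulVecLin_apply]
    constructor
    · intro hw
      obtain ⟨s, rfl⟩ := hks w hw
      rw [mulVec_smul, hQk, smul_zero]
    · intro hw
      obtain ⟨s, rfl⟩ := hls w hw
      have : l = t⁻¹ • t • l := by rw [smul_smul, inv_mul_cancel₀ ht, one_smul]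
      rw [this, mulVec_smul, mulVec_smul, hk, smul_zero, smul_zero]
  let g : Matrix (Fin 4) (Fin 4) ℝ := of (Fin.snoc (α := fun _ => Fin 4 → ℝ) P r)
  have hg1 (w : Fin 4 → ℝ) (i : Fin 3) : g.mulVec w i.castSucc = (of P).mulVec w i := by
    simp [g, mulVec]
  have hg2 (w : Fin 4 → ℝ) : g.mulVec w 3 = r ⬝ᵥ w := by
    have : g.mulVec w (Fin.last 3) = r ⬝ᵥ w := 
      congrArg (· ⬝ᵥ w) (Fin.snoc_last (α := fun _ => Fin 4 → ℝ) r P)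
    exact this
  have hg : g.det ≠ 0 := by
    intro h0
    obtain ⟨w, hw0, hw⟩ := exists_mulVec_eq_zero_iff.2 h0
    obtain ⟨t, rfl⟩ := hks w (funext fun i => by rw [← hg1, hw]; rfl)
    have := hg2 (t • k)
    rw [hw, dotProduct_smul, smul_eq_mul, Pi.zero_apply] at this
    rcases mul_eq_zero.1 this.symm with rfl | h
    · simp at hw0
    · exact hrk h
  let G : GL (Fin 4) ℝ := GeneralLinearGroup.mkOfDetNeZero g hg
  let g' : Matrix (Fin 4) (Fin 4) ℝ := (G⁻¹ : GL (Fin 4) ℝ)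
  have hgg' : g * g' = 1 := by
    change (G : Matrix (Fin 4) (Fin 4) ℝ) * (G⁻¹ : GL (Fin 4) ℝ) = 1
    rw [← Units.val_mul, mul_inv_cancel, Units.val_one]
  have hg'g : g' * g = 1 := mul_eq_one_comm.1 hgg'
  let u := transform g g' 1 1 (fun _ => 1) (P, Q, Γ)
  have hu1 : u.1 = stdCamera := by
    have : of P = of stdCamera * g := by
      ext i j
      have h := stdCamera_mulVec (fun a => g a j) i
      simp only [mulVec, dotProduct] at h
      rw [mul_apply, h]
      simp [g]
    have h : of P * g' = of stdCamera := by rw [this, Matrix.mul_assoc, hgg', Matrix.mul_one]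
    funext i j
    simp only [u, transform, LinearMap.coe_mk, AddHom.coe_mk, one_mul, h]
    rfl
  have hu2 : of u.2.1 = of Q * g' := by
    ext i j
    simp [u, transform]
  have hu3 (i : Fin 7) : u.2.2 i = g.mulVec (Γ i) := by
    ext j
    simp [u, transform]
  have hker (w : Fin 4 → ℝ) : g.mulVec (g'.mulVec w) = w := by
    rw [mulVec_mulVec, hgg', one_mulVec]
  -- A kernel vector of the left block would put the second center on the plane `r = 0`.
  have hdet : (leftBlock u.2.1).det ≠ 0 := by
    intro h0
    obtain ⟨y, hy0, hy⟩ := exists_mulVec_eq_zero_iff.2 h0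
    let w : Fin 4 → ℝ := Fin.snoc (α := fun _ => ℝ) y 0
    have hw : firstThree w = y := funext fun i => by simp [firstThree, w]
    have hw3 : w 3 = 0 := by
      have : w (Fin.last 3) = 0 := Fin.snoc_last (α := fun _ => ℝ) 0 y
      exact this
    have h := camera_mulVec u.2.1 w
    rw [hw, hw3, hy, zero_smul, add_zero, hu2, ← mulVec_mulVec] at h
    obtain ⟨t, ht⟩ := hls _ h
    have h3 := hg2 (g'.mulVec w)
    rw [hker, hw3, ht, dotProduct_smul, smul_eq_mul] at h3
    have h4 : t = 0 := (mul_eq_zero.1 h3.symm).resolve_right hrl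
    rw [h4, zero_smul] at ht
    have h5 := hker w
    rw [ht, mulVec_zero] at h5
    apply hy0
    rw [← hw, ← h5]
    rfl
  have hcol : lastColumn u.2.1 ≠ 0 := by
    intro h0
    let w : Fin 4 → ℝ := Pi.single 3 1
    have hw : firstThree w = 0 := funext fun i => by
      fin_cases i <;> simp [firstThree, w]
    have h := camera_mulVec u.2.1 w
    rw [hw, h0, mulVec_zero, smul_zero, add_zero, hu2, ← mulVec_mulVec] at h
    have hPw : (of P).mulVec (g'.mulVec w) = 0 := by
      funext i
      rw [← hg1, hker]
      exact congrFun hw i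
    obtain ⟨t, ht⟩ := hks _ hPw
    rw [ht, mulVec_smul] at h
    rcases smul_eq_zero.1 h with rfl | h
    · have h5 := hker w
      rw [ht, zero_smul, mulVec_zero] at h5
      have := congrFun h5 3
      simp [w] at this
    · exact hQk h
  have hM (M : Matrix (Fin 3) (Fin 4) ℝ) (w : Fin 4 → ℝ) :
      (M * g').mulVec (g.mulVec w) = M.mulVec w := by
    rw [mulVec_mulVec, Matrix.mul_assoc, hg'g, Matrix.mul_one]
  have hu1' : of u.1 = of P * g' := by
    ext i j
    simp [u, transform]
  have hu : IsScene u := by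
    constructor
    · rw [hu1', rank_mul_eq_left_of_isUnit_det _ _ (by
        rw [isUnit_iff_ne_zero]; exact left_ne_zero_of_mul_eq_one (by rw [← det_mul, hg'g, det_one])), hP]
    · rw [hu2, rank_mul_eq_left_of_isUnit_det _ _ (by
        rw [isUnit_iff_ne_zero]; exact left_ne_zero_of_mul_eq_one (by rw [← det_mul, hg'g, det_one])), hQ]
    · intro h
      have h3 : g.mulVec k ∈ LinearMap.ker (of u.1).mulVecLin := by
        rw [LinearMap.mem_ker, mulVecLin_apply, hu1', hM, hk]
      rw [h, LinearMap.mem_ker, mulVecLin_apply, hu2, hM] at h3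
      exact hQk h3
    · intro i
      rw [hu1', hu3, hM]
      exact h1 i
    · intro i
      rw [hu2, hu3, hM]
      exact h2 i
  refine ⟨⟨u, hu⟩, ⟨G, 1, 1, fun _ => 1, ?_⟩, hu1, hdet, hcol⟩
  simp only [Units.val_one]
  rfl

end SevenPoint
end

noncomputable section
namespace SevenPoint
open MvPolynomial Matrix

/-! ### Fundamental matrices -/

/-- The matrix of the cross product with `m`. -/
def crossMatrix (m : Fin 3 → ℝ) : Matrix (Fin 3) (Fin 3) ℝ :=
  !![0, -m 2, m 1; m 2, 0, -m 0; -m 1, m 0, 0]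

lemma dotProduct_crossMatrix_mulVec (u m w : Fin 3 → ℝ) :
    u ⬝ᵥ crossMatrix m *ᵥ w = u 0 * (m 1 * w 2 - m 2 * w 1) + u 1 * (m 2 * w 0 - m 0 * w 2) +
      u 2 * (m 0 * w 1 - m 1 * w 0) := by
  simp [crossMatrix, dotProduct, mulVec, Fin.sum_univ_three]
  ring

lemma crossMatrix_mulVec_eq_zero {m w : Fin 3 → ℝ} (hm : m ≠ 0) (h : crossMatrix m *ᵥ w = 0) :
    ∃ s : ℝ, w = s • m := by
  have hmm : m ⬝ᵥ m ≠ 0 := fun h => hm (dotProduct_self_eq_zero.1 h)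
  have h0 := congrFun h 0
  have h1 := congrFun h 1
  have h2 := congrFun h 2
  refine ⟨(m ⬝ᵥ w) / (m ⬝ᵥ m), funext fun i => ?_⟩
  rw [Pi.smul_apply, smul_eq_mul, div_mul_eq_mul_div, eq_div_iff hmm]
  simp [crossMatrix, mulVec, dotProduct, Fin.sum_univ_three] at h0 h1 h2 ⊢
  fin_cases i
  · simp
    linear_combination m 2 * h1 - m 1 * h2
  · simp
    linear_combination m 0 * h2 - m 2 * h0
  · simp
    linear_combination m 1 * h0 - m 0 * h1

lemma crossMatrix_mul_eq_zero {m : Fin 3 → ℝ} {N : Matrix (Fin 3) (Fin 3) ℝ} (hm : m ≠ 0)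
    (h : crossMatrix m * N = 0) : ∃ v, N = vecMulVec m v := by
  have (j : Fin 3) : ∃ s : ℝ, N.col j = s • m :=
    crossMatrix_mulVec_eq_zero hm (funext fun i => congrFun (congrFun h i) j)
  choose v hv using this
  refine ⟨v, ?_⟩
  ext i j
  have := congrFun (hv j) i
  rw [vecMulVec_apply, mul_comm]
  exact this

lemma exists_vec_eq {R : Type} (y : Fin 9 → R) : ∃ F, vec F = y := by
  refine ⟨!![y 0, y 1, y 2; y 3, y 4, y 5; y 6, y 7, y 8], ?_⟩
  rw [vec_eq]
  funext k
  fin_cases k <;> rfl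

lemma vec_injective {R : Type} : Function.Injective (vec : Matrix (Fin 3) (Fin 3) R → _) := by
  intro F G h
  ext i j
  have := congrFun h ⟨3 * i + j, by omega⟩
  fin_cases i <;> fin_cases j <;> exact this

lemma pencilCubic_crossMatrix_mul_a (m : Fin 3 → ℝ) (M : Matrix (Fin 3) (Fin 3) ℝ)
    (y : Fin 9 → ℝ) : (pencilCubic (vec (crossMatrix m * M)) y).a = 0 := by
  simp [pencilCubic, detSum, vec_eq, crossMatrix, vecMul, dotProduct, Fin.sum_univ_three]
  ring

/-- The coefficient is `tr (adj F₀ * F)` for `F₀ = [m]ₓ M`, and `adj F₀ = adj M * m mᵀ`. Its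
vanishing says that `F` is tangent to `det = 0` at `F₀`. -/
lemma pencilCubic_crossMatrix_mul_b (m : Fin 3 → ℝ) (M F : Matrix (Fin 3) (Fin 3) ℝ) :
    (pencilCubic (vec (crossMatrix m * M)) (vec F)).b = m ⬝ᵥ F *ᵥ M.adjugate *ᵥ m := by
  simp [pencilCubic, detSum, vec_eq, crossMatrix, vecMul, dotProduct, Fin.sum_univ_three,
    adjugate_fin_three, mulVec]
  ring

/-- When the coefficients of `t³` and `t²` both vanish, the cubic has a double root at infinity. -/
lemma discr_pencilCubic_crossMatrix_mul {m : Fin 3 → ℝ} {M F : Matrix (Fin 3) (Fin 3) ℝ}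
    (h : m ⬝ᵥ F *ᵥ M.adjugate *ᵥ m = 0) :
    (pencilCubic (vec (crossMatrix m * M)) (vec F)).discr = 0 := by
  rw [← pencilCubic_crossMatrix_mul_b] at h
  rw [Cubic.discr, pencilCubic_crossMatrix_mul_a, h]
  ring

lemma dotProduct_fundamentalMatrix (m p : Fin 3 → ℝ) (t : ℝ) :
    (p + t • m) ⬝ᵥ crossMatrix m *ᵥ p = 0 := by
  rw [dotProduct_crossMatrix_mulVec]
  simp
  ring

/-- The derivative of the epipolar constraint. The image vectors change only by scaling, so
differentiating them contributes nothing, and the derivative of the fundamental matrix satisfies the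
same constraint. -/
lemma dotProduct_fundamentalMatrix_deriv {m m' p p' : Fin 3 → ℝ} {t t' α β : ℝ}
    (h : p' + α • p + t • m' + t' • m = β • (p + t • m)) :
    (p + t • m) ⬝ᵥ (crossMatrix m' *ᵥ p + crossMatrix m *ᵥ p') = 0 := by
  have e : p' = β • (p + t • m) - α • p - t • m' - t' • m := by
    rw [← h]
    abel
  rw [e, dotProduct_add, dotProduct_crossMatrix_mulVec, dotProduct_crossMatrix_mulVec]
  simp
  ring

/-- All matrices `[m]ₓ M` have determinant zero, so the derivative of a family of them is tangent to
`det = 0`. -/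
lemma dotProduct_fundamentalMatrix_deriv_adjugate (m m' : Fin 3 → ℝ)
    (M M' : Matrix (Fin 3) (Fin 3) ℝ) :
    m ⬝ᵥ (crossMatrix m' * M + crossMatrix m * M') *ᵥ M.adjugate *ᵥ m = 0 := by
  rw [add_mulVec, ← mulVec_mulVec, ← mulVec_mulVec, mulVec_mulVec _ M, mul_adjugate,
    dotProduct_add, dotProduct_crossMatrix_mulVec, dotProduct_crossMatrix_mulVec, smul_mulVec,
    one_mulVec]
  simp
  ring

lemma exists_eq_smul_of_bracket_eq_zero {x y : Fin 9 → ℝ} (hx : x ≠ 0)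
    (h : ∀ k l, bracket x y k l = 0) : ∃ c : ℝ, y = c • x := by
  obtain ⟨k, hk⟩ := Function.ne_iff.1 hx
  refine ⟨y k / x k, funext fun l => ?_⟩
  have := h k l
  simp only [bracket, Pi.zero_apply] at this hk
  rw [Pi.smul_apply, smul_eq_mul, div_mul_eq_mul_div, eq_div_iff hk]
  linear_combination this

/-- A family of two-view correspondences `yᵢ ↔ zᵢ = M yᵢ + tᵢ m` with a first-order deformation
that does not change the images comes from the infinitesimal action fixing the first camera,
unless the discriminant vanishes on the space of matrices satisfying the epipolar constraints. -/
theorem deformation_trivial_of_discr_ne_zero {L : Matrix (Fin 7) (Fin 9) ℝ}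
    {M M' : Matrix (Fin 3) (Fin 3) ℝ} {m m' : Fin 3 → ℝ} {y : Fin 7 → Fin 3 → ℝ}
    {t t' α β : Fin 7 → ℝ}
    (hL : ∀ F, L.mulVec (vec F) = 0 ↔ ∀ i, (M *ᵥ y i + t i • m) ⬝ᵥ F *ᵥ y i = 0)
    (hM : M.det ≠ 0) (hm : m ≠ 0) (hy : ∀ i, y i ≠ 0) (hz : ∀ i, M *ᵥ y i + t i • m ≠ 0)
    (h : ∀ i, M' *ᵥ y i + α i • M *ᵥ y i + t i • m' + t' i • m = β i • (M *ᵥ y i + t i • m))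
    (hne : aeval (pluckerOfKer L) discrPolynomial ≠ 0) :
    ∃ (b ω : ℝ) (v : Fin 3 → ℝ), m' = (b - ω) • m ∧ M' = b • M + vecMulVec m v ∧
      ∀ i, t' i = (α i + ω) * t i - v ⬝ᵥ y i := by
  have hMu : IsUnit M := (isUnit_iff_isUnit_det _).2 (isUnit_iff_ne_zero.2 hM)
  have hF0 : crossMatrix m * M ≠ 0 := by
    intro h0
    have h1 : crossMatrix m = 0 := hMu.mul_left_eq_zero.1 h0
    apply hm
    have e0 := congrFun (congrFun h1 2) 1
    have e1 := congrFun (congrFun h1 0) 2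
    have e2 := congrFun (congrFun h1 1) 0
    simp [crossMatrix] at e0 e1 e2
    funext i
    fin_cases i <;> simp [e0, e1, e2]
  have hvF0 : vec (crossMatrix m * M) ≠ 0 := fun h0 =>
    hF0 (vec_injective (h0.trans (funext fun _ => rfl)))
  have hLF0 : L.mulVec (vec (crossMatrix m * M)) = 0 := (hL _).2 fun i => by
    rw [← mulVec_mulVec, dotProduct_fundamentalMatrix]
  -- Otherwise the point lies on the baseline and both its images are epipoles. Its constraint on
  -- `F` is then, up to a nonzero factor, the tangency condition at `[m]ₓ M`, so every pencil
  -- through that matrix in `ker L` has discriminant zero.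
  have hbase (i : Fin 7) (κ : ℝ) : M *ᵥ y i ≠ κ • m := by
    intro hκ
    apply hne
    refine aeval_pluckerOfKer_eq_zero hLF0 hvF0 fun w hw => ?_
    obtain ⟨F, rfl⟩ := exists_vec_eq w
    apply discr_pencilCubic_crossMatrix_mul
    have h1 := (hL F).1 hw i
    have h2 := hz i
    rw [hκ, ← add_smul] at h1 h2
    have h3 : κ + t i ≠ 0 := fun h3 => h2 (by rw [h3, zero_smul])
    have h4 : κ ≠ 0 := by
      rintro rfl
      rw [zero_smul] at hκ
      exact hM (exists_mulVec_eq_zero_iff.1 ⟨_, hy i, hκ⟩)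
    have h5 : κ • M.adjugate *ᵥ m = M.det • y i := by
      rw [← mulVec_smul, ← hκ, mulVec_mulVec, adjugate_mul, smul_mulVec, one_mulVec]
    have h6 : κ * (κ + t i) * (m ⬝ᵥ F *ᵥ M.adjugate *ᵥ m) = 0 := by
      calc _ = ((κ + t i) • m) ⬝ᵥ F *ᵥ (κ • M.adjugate *ᵥ m) := by
            rw [mulVec_smul, dotProduct_smul, smul_dotProduct, smul_eq_mul, smul_eq_mul, mul_assoc]
        _ = 0 := by rw [h5, mulVec_smul, dotProduct_smul, h1, smul_zero]
    exact (mul_eq_zero.1 h6).resolve_left (mul_ne_zero h4 h3)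
  have hLF' : L.mulVec (vec (crossMatrix m' * M + crossMatrix m * M')) = 0 := (hL _).2 fun i => by
    rw [add_mulVec, ← mulVec_mulVec, ← mulVec_mulVec, dotProduct_fundamentalMatrix_deriv (h i)]
  -- If the fundamental matrix and its derivative were independent, they would span a pencil in `ker
  -- L` with discriminant zero.
  obtain ⟨μ, hμ⟩ := exists_eq_smul_of_bracket_eq_zero hvF0 fun k l => by
    by_contra hkl
    exact hne (aeval_pluckerOfKer_eq_zero_of_discr hLF0 hLF' (discr_pencilCubic_crossMatrix_mul
      (dotProduct_fundamentalMatrix_deriv_adjugate m m' M M')) hkl)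
  replace hμ : crossMatrix m' * M + crossMatrix m * M' = μ • (crossMatrix m * M) :=
    vec_injective hμ
  -- Multiplying by `mᵀ` on the left kills `[m]ₓ`. What remains is `mᵀ [m']ₓ M = 0`, so `m` and `m'`
  -- are parallel.
  obtain ⟨s, rfl⟩ : ∃ s : ℝ, m' = s • m := by
    apply crossMatrix_mulVec_eq_zero hm
    have h1 : m ᵥ* (crossMatrix m' * M) = 0 := by
      have e : m ᵥ* crossMatrix m = 0 := by
        funext i
        fin_cases i <;> simp [crossMatrix, vecMul, dotProduct, Fin.sum_univ_three] <;> ring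
      rw [eq_sub_of_add_eq hμ, vecMul_sub, vecMul_smul, ← vecMul_vecMul, ← vecMul_vecMul, e,
        zero_vecMul, zero_vecMul, smul_zero, sub_zero]
    rw [← vecMul_vecMul] at h1
    have h2 : m ᵥ* crossMatrix m' = 0 := by
      by_contra h2
      exact hM (exists_vecMul_eq_zero_iff.1 ⟨_, h2, h1⟩)
    rw [← h2]
    funext i
    fin_cases i <;> simp [crossMatrix, vecMul, mulVec, dotProduct, Fin.sum_univ_three] <;> ring
  obtain ⟨v, hv⟩ : ∃ v, M' - (μ - s) • M = vecMulVec m v := by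
    apply crossMatrix_mul_eq_zero hm
    have e : crossMatrix (s • m) = s • crossMatrix m := by
      ext i j
      fin_cases i <;> fin_cases j <;> simp [crossMatrix]
    rw [e, smul_mul] at hμ
    rw [mul_sub, Matrix.mul_smul, sub_smul, ← hμ]
    abel
  refine ⟨μ - s, μ - 2 * s, v, by congr 1; ring, by rw [← hv]; abel, fun i => ?_⟩
  have hi := h i
  have hM' : M' = (μ - s) • M + vecMulVec m v := by rw [← hv]; abel
  have hmv : vecMulVec m v *ᵥ y i = (v ⬝ᵥ y i) • m := by
    rw [vecMulVec_mulVec, op_smul_eq_smul]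
  rw [hM', add_mulVec, smul_mulVec, hmv] at hi
  have h1 : (β i - α i - (μ - s)) • M *ᵥ y i = (v ⬝ᵥ y i + t i * s + t' i - β i * t i) • m := by
    rw [← sub_eq_zero] at hi ⊢
    rw [← neg_eq_zero, ← hi]
    module
  -- Here `M yᵢ` and `m` are independent because the point is off the baseline, so both coefficients
  -- in `h1` vanish. The coefficient of `m` then gives the formula for `t'`.
  have h2 : β i - α i - (μ - s) = 0 := by
    by_contra h2
    apply hbase i ((β i - α i - (μ - s))⁻¹ * (v ⬝ᵥ y i + t i * s + t' i - β i * t i))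
    rw [mul_smul, ← h1, smul_smul, inv_mul_cancel₀ h2, one_smul]
  rw [h2, zero_smul] at h1
  have h3 := (smul_eq_zero.1 h1.symm).resolve_right hm
  linear_combination h3 + t i * h2

end SevenPoint
end

noncomputable section
namespace SevenPoint
open MvPolynomial Matrix

/-! ### First-order deformations of world scenes -/

/-- By the quotient rule, a stationary projection means that the homogeneous vector moves along
itself. The factor is read off the third coordinate. -/
lemma exists_eq_smul_of_hasDerivAt_proj {M N : Fin 3 → Fin 4 → ℝ} {w z : Fin 4 → ℝ}
    (h : HasDerivAt (fun s : ℝ => proj ((of (M + s • N)).mulVec (w + s • z))) 0 0)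
    (h0 : (of M).mulVec w 2 ≠ 0) :
    ∃ k : ℝ, (of N).mulVec w + (of M).mulVec z = k • (of M).mulVec w := by
  have hr (r : Fin 3) : HasDerivAt (fun s : ℝ => (of (M + s • N)).mulVec (w + s • z) r)
      (((of N).mulVec w + (of M).mulVec z) r) 0 := by
    have e : (fun s : ℝ => (of (M + s • N)).mulVec (w + s • z) r) = fun s : ℝ =>
        (of M).mulVec w r + s * ((of N).mulVec w + (of M).mulVec z) r
          + s ^ 2 * (of N).mulVec z r := by
      funext s
      rw [← of_add_of, ← smul_of, add_mulVec, mulVec_add, mulVec_add, smul_mulVec, mulVec_smul,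
        smul_mulVec, mulVec_smul]
      simp only [Pi.add_apply, Pi.smul_apply, smul_eq_mul]
      ring
    rw [e]
    have := (((hasDerivAt_id (0 : ℝ)).mul_const (((of N).mulVec w + (of M).mulVec z) r)).const_add
      ((of M).mulVec w r)).add (((hasDerivAt_id (0 : ℝ)).pow 2).mul_const ((of N).mulVec z r))
    exact this.congr_deriv (by simp)
  set d := (of N).mulVec w + (of M).mulVec z
  rw [hasDerivAt_pi] at h
  have hc (c : Fin 2) : d c.castSucc = d 2 / (of M).mulVec w 2 * (of M).mulVec w c.castSucc := by
    have h1 := ((hr c.castSucc).div (hr 2) (by simpa using h0)).unique (h c)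
    simp only [zero_smul, add_zero, Pi.zero_apply] at h1
    rw [div_eq_zero_iff] at h1
    have h2 := h1.resolve_right (pow_ne_zero 2 h0)
    field_simp
    linear_combination h2
  refine ⟨d 2 / (of M).mulVec w 2, funext fun i => ?_⟩
  rw [Pi.smul_apply, smul_eq_mul]
  induction i using Fin.lastCases with
  | last => exact (div_mul_cancel₀ _ h0).symm
  | cast c => exact hc c

lemma exists_eq_smul_of_fderiv_eq_zero (v : {v : Ambient // IsScene v}) {δ : Ambient}
    (hδ : fderiv ℝ forwardRep v.1 δ = 0) (i : Fin 7) :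
    (∃ α : ℝ, (of δ.1).mulVec (v.1.2.2 i) + (of v.1.1).mulVec (δ.2.2 i) =
      α • (of v.1.1).mulVec (v.1.2.2 i)) ∧
    ∃ β : ℝ, (of δ.2.1).mulVec (v.1.2.2 i) + (of v.1.2.1).mulVec (δ.2.2 i) =
      β • (of v.1.2.1).mulVec (v.1.2.2 i) := by
  have hl : HasDerivAt (fun s : ℝ => v.1 + s • δ) δ 0 := by
    simpa using ((hasDerivAt_id (0 : ℝ)).smul_const δ).const_add v.1
  have h : HasDerivAt (fun s : ℝ => forwardRep (v.1 + s • δ)) 0 0 := by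
    have hf : HasFDerivAt forwardRep (fderiv ℝ forwardRep v.1) (v.1 + (0 : ℝ) • δ) := by
      simpa using (differentiableAt_forwardRep v).hasFDerivAt
    rw [← hδ]
    exact hf.comp_hasDerivAt (0 : ℝ) hl
  have hi := hasDerivAt_pi.1 h i
  have h1 := (ContinuousLinearMap.fst ℝ (Fin 2 → ℝ) (Fin 2 → ℝ)).hasFDerivAt.comp_hasDerivAt
    (0 : ℝ) hi
  have h2 := (ContinuousLinearMap.snd ℝ (Fin 2 → ℝ) (Fin 2 → ℝ)).hasFDerivAt.comp_hasDerivAt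
    (0 : ℝ) hi
  exact ⟨exists_eq_smul_of_hasDerivAt_proj h1 (v.2.finite_fst i),
    exists_eq_smul_of_hasDerivAt_proj h2 (v.2.finite_snd i)⟩

/-- The group has dimension `16 + 1 + 1 + 7 = 25`, and scalar matrices compensated by rescaling act
trivially. -/
lemma finrank_orbitTangent_le (v : Ambient) : Module.finrank ℝ (orbitTangent v) ≤ 24 := by
  have h := LinearMap.finrank_range_add_finrank_ker (infinitesimalAction v)
  have hd : Module.finrank ℝ (Matrix (Fin 4) (Fin 4) ℝ × ℝ × ℝ × (Fin 7 → ℝ)) = 25 := by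
    simp [Module.finrank_matrix]
  have hk : (1, 1, 1, fun _ => -1) ∈ LinearMap.ker (infinitesimalAction v) := by
    rw [LinearMap.mem_ker]
    ext <;> simp [infinitesimalAction]
  have : Nontrivial (LinearMap.ker (infinitesimalAction v)) :=
    nontrivial_of_ne ⟨_, hk⟩ 0 fun h => one_ne_zero (α := ℝ)
      (congrArg (fun X : LinearMap.ker (infinitesimalAction v) => X.1.2.1) h)
  have := Module.finrank_pos (R := ℝ) (M := LinearMap.ker (infinitesimalAction v))
  rw [hd] at h
  exact (by omega : Module.finrank ℝ (LinearMap.range (infinitesimalAction v)) ≤ 24)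

/-- A rank below 28 on a space of dimension 52 leaves a kernel of dimension more than 24, too large
for the orbit directions. -/
lemma exists_fderiv_eq_zero_of_finrank_lt (v : {v : Ambient // IsScene v})
    (h : Module.finrank ℝ (LinearMap.range (differentialForward v)) < 28) :
    ∃ δ, fderiv ℝ forwardRep v.1 δ = 0 ∧ δ ∉ orbitTangent v.1 := by
  by_contra! hle
  have h1 : Module.finrank ℝ (LinearMap.ker (fderiv ℝ forwardRep v.1).toLinearMap) ≤
      Module.finrank ℝ (orbitTangent v.1) := Submodule.finrank_mono fun δ hδ => hle δ hδ
  have h2 := finrank_orbitTangent_le v.1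
  have h3 := LinearMap.finrank_range_add_finrank_ker (fderiv ℝ forwardRep v.1).toLinearMap
  have hd : Module.finrank ℝ Ambient = 52 := by simp [Module.finrank_pi_fintype]
  rw [differentialForward, Submodule.range_liftQ] at h
  omega

/-! ### The discriminant on the ill-posed locus -/

lemma epipolarMatrix_mulVec_vec (x : ImageData ℝ) (F : Matrix (Fin 3) (Fin 3) ℝ) (i : Fin 7) :
    (epipolarMatrix x).mulVec (vec F) i = homogenize (x i).2 ⬝ᵥ F *ᵥ homogenize (x i).1 := by
  simp [epipolarMatrix, mulVec, dotProduct, vec_eq, Fin.sum_univ_succ, vecMulVec_apply]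
  ring

lemma homogenize_proj {u : Fin 3 → ℝ} (hu : u 2 ≠ 0) : homogenize (proj u) = (u 2)⁻¹ • u := by
  funext i
  fin_cases i <;> simp [homogenize, proj, div_eq_inv_mul, hu]

lemma epipolarMatrix_forwardRep_mulVec_vec {v : Ambient} (hv : IsScene v)
    (F : Matrix (Fin 3) (Fin 3) ℝ) :
    (epipolarMatrix (forwardRep v)).mulVec (vec F) = 0 ↔
      ∀ i, (of v.2.1).mulVec (v.2.2 i) ⬝ᵥ F *ᵥ (of v.1).mulVec (v.2.2 i) = 0 := by
  rw [funext_iff]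
  refine forall_congr' fun i => ?_
  rw [epipolarMatrix_mulVec_vec, forwardRep, homogenize_proj (hv.finite_fst i),
    homogenize_proj (hv.finite_snd i), mulVec_smul, dotProduct_smul, smul_dotProduct, Pi.zero_apply,
    smul_eq_zero_iff_right (inv_ne_zero (hv.finite_fst i)),
    smul_eq_zero_iff_right (inv_ne_zero (hv.finite_snd i))]

lemma aeval_entries_inImageData (x : ImageData ℝ) (p : MvPolynomial PluckerIndex ℤ) :
    aeval (entries x) (inImageData p) = aeval (pluckerOfKer (epipolarMatrix x)) p := by
  set φ := aeval (R := ℤ) (entries x) with hφ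
  rw [inImageData, ← AlgHom.comp_apply, comp_aeval]
  congr 2
  funext k
  change φ (pluckerOfKer (epipolarMatrix genericImageData) k) = _
  rw [map_pluckerOfKer, map_epipolarMatrix]
  congr 2
  funext i
  ext c <;> simp [φ, genericImageData, entries]

lemma aeval_pluckerOfKer_eq_zero_of_normalForm (u : {v : Ambient // IsScene v})
    (h1 : u.1.1 = stdCamera) (hM : (leftBlock u.1.2.1).det ≠ 0) (hm : lastColumn u.1.2.1 ≠ 0)
    (h : Module.finrank ℝ (LinearMap.range (differentialForward u)) < 28) :
    aeval (pluckerOfKer (epipolarMatrix (forwardRep u.1))) discrPolynomial = 0 := by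
  by_contra hne
  obtain ⟨δ₀, hδ₀, hδ₀'⟩ := exists_fderiv_eq_zero_of_finrank_lt u h
  -- Since the first camera is `[I | 0]`, its deformation is cancelled by the infinitesimal
  -- coordinate change with the same first three rows.
  let A₀ : Matrix (Fin 4) (Fin 4) ℝ := of (Fin.snoc (α := fun _ => Fin 4 → ℝ) δ₀.1 0)
  set δ := δ₀ + infinitesimalAction u.1 (A₀, 0, 0, 0) with hδdef
  have hδ : fderiv ℝ forwardRep u.1 δ = 0 := by
    rw [hδdef, map_add, hδ₀, zero_add]
    exact orbitTangent_le_ker u ⟨_, rfl⟩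
  have hδ' : δ ∉ orbitTangent u.1 := fun hmem =>
    hδ₀' ((Submodule.add_mem_iff_left _ (LinearMap.mem_range_self _ _)).1 hmem)
  have hstd (A : Matrix (Fin 4) (Fin 4) ℝ) (i : Fin 3) (j : Fin 4) :
      (of stdCamera * A) i j = A i.castSucc j := stdCamera_mulVec (fun a => A a j) i
  have hδ1 : δ.1 = 0 := by
    funext i j
    have : δ.1 i j = δ₀.1 i j + (0 * u.1.1 i j - (of u.1.1 * A₀) i j) := rfl
    rw [this, h1, hstd]
    simp [A₀]
  clear_value δ
  clear hδdef hδ₀ hδ₀'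
  choose hα hβ using exists_eq_smul_of_fderiv_eq_zero u hδ
  choose α hα using hα
  choose β hβ using hβ
  have hstd' (w : Fin 4 → ℝ) : (of stdCamera).mulVec w = firstThree w :=
    funext (stdCamera_mulVec w)
  have hα' (i : Fin 7) : firstThree (δ.2.2 i) = α i • firstThree (u.1.2.2 i) := by
    rw [← hstd', ← hstd', ← h1, ← hα, hδ1]
    simp
  obtain ⟨b, ω, v, hm', hM', ht⟩ := deformation_trivial_of_discr_ne_zero
    (M := leftBlock u.1.2.1) (M' := leftBlock δ.2.1) (m := lastColumn u.1.2.1)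
    (m' := lastColumn δ.2.1) (y := fun i => firstThree (u.1.2.2 i)) (t := fun i => u.1.2.2 i 3)
    (t' := fun i => δ.2.2 i 3) (α := α) (β := β) (fun F => by
      rw [epipolarMatrix_forwardRep_mulVec_vec u.2]
      simp only [h1, hstd', camera_mulVec]) hM hm
    (fun i h0 => u.2.finite_fst i (by rw [h1, hstd', h0]; rfl))
    (fun i h0 => u.2.finite_snd i (by rw [camera_mulVec, h0]; rfl))
    (fun i => by
      rw [← camera_mulVec, ← hβ, camera_mulVec, camera_mulVec, hα', mulVec_smul]
      abel) hne
  apply hδ'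
  -- The infinitesimal coordinate changes that fix `[I | 0]` have only a last row. The row `(-v, ω)`
  -- adds `m vᵀ` to the left block and `-ω m` to the last column of the second camera, matching
  -- `hM'` and `hm'`; on the points it gives `ht`.
  let r : Fin 4 → ℝ := Fin.snoc (α := fun _ => ℝ) (-v) ω
  let A : Matrix (Fin 4) (Fin 4) ℝ := of (Fin.snoc (α := fun _ => Fin 4 → ℝ) 0 r)
  have hA (i : Fin 3) (j : Fin 4) : A i.castSucc j = 0 := by simp [A]
  have hA' : A (Fin.last 3) = r := 
    Fin.snoc_last (α := fun _ => Fin 4 → ℝ) r (0 : Fin 3 → Fin 4 → ℝ)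
  have hr (j : Fin 3) : r j.castSucc = -v j := by simp [r]
  have hr' : r (Fin.last 3) = ω := Fin.snoc_last (α := fun _ => ℝ) ω (-v)
  have hQA (i : Fin 3) (j : Fin 4) : (of u.1.2.1 * A) i j = u.1.2.1 i 3 * r j := by
    rw [mul_apply, Fin.sum_univ_castSucc, ← hA']
    simp only [hA, mul_zero, Finset.sum_const_zero, zero_add]
    rfl
  refine ⟨(A, 0, b, α), Prod.ext ?_ (Prod.ext ?_ ?_)⟩
  · funext i j
    change 0 * u.1.1 i j - (of u.1.1 * A) i j = δ.1 i j
    rw [hδ1, h1, hstd, hA, zero_mul, sub_zero]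
    rfl
  · funext i j
    change b * u.1.2.1 i j - (of u.1.2.1 * A) i j = δ.2.1 i j
    rw [hQA]
    induction j using Fin.lastCases with
    | last =>
      have : δ.2.1 i (Fin.last 3) = (b - ω) * u.1.2.1 i (Fin.last 3) := congrFun hm' i
      rw [this, hr']
      change b * _ - u.1.2.1 i (Fin.last 3) * _ = _
      ring
    | cast j =>
      have : δ.2.1 i j.castSucc = b * u.1.2.1 i j.castSucc + u.1.2.1 i 3 * v j :=
        congrFun (congrFun hM' i) j
      rw [this, hr]
      ring
  · funext k i
    change α k * u.1.2.2 k i + A.mulVec (u.1.2.2 k) i = δ.2.2 k i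
    induction i using Fin.lastCases with
    | last =>
      have h2 : δ.2.2 k (Fin.last 3) = _ := ht k
      have h3 : A.mulVec (u.1.2.2 k) (Fin.last 3) = r ⬝ᵥ u.1.2.2 k := congrArg (· ⬝ᵥ u.1.2.2 k) hA'
      rw [h2, h3, dotProduct, Fin.sum_univ_castSucc, hr']
      simp only [hr, dotProduct, neg_mul, Finset.sum_neg_distrib, firstThree]
      change _ * u.1.2.2 k 3 + (_ + _ * u.1.2.2 k 3) = _
      ring
    | cast i =>
      have h2 : δ.2.2 k i.castSucc = α k * u.1.2.2 k i.castSucc := congrFun (hα' k) i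
      rw [h2, mulVec, dotProduct]
      simp [hA]

theorem aeval_entries_eq_zero_of_mem_illImage {x : ImageData ℝ} (hx : x ∈ illImage) :
    aeval (entries x) (inImageData discrPolynomial) = 0 := by
  obtain ⟨w, hw, rfl⟩ := hx
  induction w using Quotient.inductionOn with | h v => ?_
  obtain ⟨u, hvu, h1, hM, hm⟩ := exists_normalForm v
  have hq : (⟦v⟧ : WorldScene) = ⟦u⟧ := Quotient.sound hvu
  rw [hq] at hw ⊢
  rw [aeval_entries_inImageData]
  exact aeval_pluckerOfKer_eq_zero_of_normalForm u h1 hM hm hw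

end SevenPoint
end

theorem mainTheorem4 :
    ∃ P : MvPolynomial SevenPoint.PluckerIndex ℤ,
      -- `P` has degree 6 and 1668 terms, with integer coefficients of absolute value at most 72
      P.IsHomogeneous 6 ∧ P.support.card = 1668 ∧ (∀ m, |P.coeff m| ≤ 72) ∧
      -- `P` is the discriminant of the cubic `det(t F₁ + F₂)`
      (∀ F₁ F₂ : Matrix (Fin 3) (Fin 3) ℝ,
        MvPolynomial.aeval (SevenPoint.pluckerOfSpan F₁ F₂) P = SevenPoint.pencilDiscr F₁ F₂) ∧
      -- as a polynomial in the image data, it has degree 6 in each of the 14 image points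
      (∀ (i : Fin 7) (s : Fin 2),
        SevenPoint.degreeInPoint (SevenPoint.inImageData P) i s = 6) ∧
      -- and it vanishes at ill-posed image data
      ∀ x ∈ SevenPoint.illImage,
        MvPolynomial.aeval (SevenPoint.entries x) (SevenPoint.inImageData P) = 0 := by
  refine ⟨SevenPoint.discrPolynomial, SevenPoint.isHomogeneous_discrPolynomial,
    SevenPoint.card_support_discrPolynomial, SevenPoint.abs_coeff_discrPolynomial_le,
    SevenPoint.aeval_pluckerOfSpan_discrPolynomial,
    SevenPoint.degreeInPoint_inImageData_discrPolynomial, fun x hx => ?_⟩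
  exact SevenPoint.aeval_entries_eq_zero_of_mem_illImage hx
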